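/- **Setting.** Let $d\ge 0$ and $d_1\ge 2d+1$ be integers. Let $f:\mathbb R\to\mathbb R$ be $2\pi$-periodic with a single jump point $\xi\in[-\pi,\pi]$: $f$ is $C^{d_1}$ on $(\xi,\xi+2\pi)$, for $l=0,\dots,d_1$ the one-sided limits of $f^{(l)}$ at $\xi$ exist, and $A_l=f^{(l)}(\xi^+)-f^{(l)}(\xi^-)$. Put $\omega=e^{-\imath\xi}$ and $c_k(g)=\frac1{2\pi}\int_{-\pi}^{\pi}g(t)e^{-\imath kt}\,dt$. Let $\Phi_{d_1}=\sum_{l=0}^{d_1}A_lV_l(\cdot\,;\xi)$, where $V_n(x;\xi)=-\frac{(2\pi)^n}{(n+1)!}B_{n+1}\!\left(\frac{x-\xi}{2\pi}\right)$ for $\xi\le x<\xi+2\pi$, extended $2\pi$-periodically ($B_n$ are the Bernoulli polynomials). Let $R^*$ be a number with $|c_k(f-\Phi_{d_1})|\le R^*k^{-d_1-2}$ for all $k\ge1$, and put $$H=\max\Big(1,\sum_{l=0}^{d}|A_l|\Big)+\max\Big(1,\sum_{l=d+1}^{d_1}|A_l|\Big)+R^*.$$ Let $r_k=2\pi(\imath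 k)^{d+1}c_k(f)$ and $q_k^d(z)=\sum_{j=0}^{d+1}(-1)^j\binom{d+1}{j}r_{k+j}z^{d+1-j}$. Given $\widetilde\omega\in\mathbb C$, the recovered jump magnitudes $\widetilde A_0,\dots,\widetilde A_d\in\mathbb C$ are defined by the $(d+1)\times(d+1)$ linear system $$r_{k+j}\,\widetilde\omega^{-(k+j)}=\sum_{l=0}^{d}(\imath(k+j))^{d-l}\widetilde A_l,\qquad j=0,\dots,d.\tag{1}$$ **Theorem.** 1. For every $C_1$ there are constants $C,K>0$, depending only on $d,d_1,C_1$, such that for all $f,\xi,(A_l),R^*$ as above, every $k>K\cdot H$ and every $\widetilde\omega$ with $|\widetilde\omega-\omega|\le C_1Hk^{-d-2}$, the system (1) has exactly one solution, and it satisfies $$|\widetilde A_l-A_l|\le C\cdot H^2\cdot k^{\,l-d-1},\qquad l=0,\dots,d.\tag{2}$$ 2. For every $J>0$ there are constants $C_1,C,K>0$, depending only on $d,d_1,J$, such that for all $f,\xi,(A_l),R^*$ as above with $|A_0|\ge J$ and every $k>K\cdot H$: the polynomial $q_k^d$ has a root closest to the unit circle (a root $\widetilde\omega$ for which $\big||\widetilde\omega|-1\big|$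 is minimal among the roots), and every such root $\widetilde\omega$ satisfies $|\widetilde\omega-\omega|\le C_1Hk^{-d-2}$; moreover the system (1) for this $\widetilde\omega$ has exactly one solution, and it satisfies (2). -/

import Mathlib

open Real Set Filter Topology

noncomputable section

namespace JumpReconstruction

/-- The `k`-th Fourier coefficient `c_k(g) = (1/2π) ∫_{-π}^{π} g(t) e^{-ikt} dt`. -/
def fourierCoef (g : ℝ → ℝ) (k : ℕ) : ℂ :=
  (1 / (2 * (π : ℂ))) * ∫ t in (-π)..π, (g t : ℂ) * Complex.exp (-(Complex.I * (k : ℂ) * (t : ℂ)))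

/-- `f` (regarded as a `2π`-periodic function) has `d₁` continuous derivatives away from the
single jump point `ξ ∈ [-π, π]`, all its derivatives of order `l ≤ d₁` have one-sided limits
at `ξ`, and `A l = f^{(l)}(ξ⁺) - f^{(l)}(ξ⁻)` is the jump magnitude of order `l`.
No condition is put on the value `f ξ`. -/
structure IsSingleJump (f : ℝ → ℝ) (ξ : ℝ) (d₁ : ℕ) (A : ℕ → ℝ) : Prop where
  mem : ξ ∈ Icc (-π) π
  periodic : Function.Periodic f (2 * π)
  contDiffOn : ContDiffOn ℝ d₁ f (Ioo ξ (ξ + 2 * π))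
  jump : ∀ l ≤ d₁, ∃ right left : ℝ,
    Tendsto (iteratedDeriv l f) (𝓝[>] ξ) (𝓝 right) ∧
    Tendsto (iteratedDeriv l f) (𝓝[<] ξ) (𝓝 left) ∧
    A l = right - left

/-- The `2π`-periodic extension of
`V_n(x; ξ) = - (2π)^n / (n+1)! * B_{n+1}((x - ξ) / 2π)`, `ξ ≤ x < ξ + 2π`,
where `B_{n+1}` is the Bernoulli polynomial. -/
def bernoulliV (n : ℕ) (ξ x : ℝ) : ℝ :=
  -((2 * π) ^ n / ((n + 1).factorial : ℝ)) *
    bernoulliFun (n + 1) (Int.fract ((x - ξ) / (2 * π)))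

/-- The periodic piecewise polynomial `Φ_n` of zero mean with jump point `ξ` and jump
magnitudes `A_0, …, A_n`. -/
def singularPart (ξ : ℝ) (A : ℕ → ℝ) (n : ℕ) (x : ℝ) : ℝ :=
  ∑ l ∈ Finset.range (n + 1), A l * bernoulliV l ξ x

/-- `R` bounds the Fourier coefficients of the smooth part `Ψ = f - Φ_{d₁}`:
`|c_k(Ψ)| ≤ R k^{-d₁-2}` for all `k ≥ 1`. -/
def SmoothPartBound (f : ℝ → ℝ) (ξ : ℝ) (d₁ : ℕ) (A : ℕ → ℝ) (R : ℝ) : Prop :=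
  ∀ k : ℕ, 1 ≤ k →
    ‖fourierCoef (fun x => f x - singularPart ξ A d₁ x) k‖ ≤ R * (k : ℝ) ^ (-(d₁ : ℤ) - 2)

/-- `max (1, ∑_{l ≤ d} |A_l|)`. -/
def lowJumpSize (d : ℕ) (A : ℕ → ℝ) : ℝ :=
  max 1 (∑ l ∈ Finset.range (d + 1), |A l|)

/-- `max (1, ∑_{d < l ≤ d₁} |A_l|)`. -/
def highJumpSize (d d₁ : ℕ) (A : ℕ → ℝ) : ℝ :=
  max 1 (∑ l ∈ Finset.Icc (d + 1) d₁, |A l|)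

/-- The size parameter `H` of the reconstruction problem. -/
def sizeH (d d₁ : ℕ) (A : ℕ → ℝ) (R : ℝ) : ℝ :=
  lowJumpSize d A + highJumpSize d d₁ A + R

/-- `ω = e^{-iξ}`. -/
def jumpPoint (ξ : ℝ) : ℂ :=
  Complex.exp (-(Complex.I * (ξ : ℂ)))

/-- The measured quantities `r_k = 2π (ik)^{d+1} c_k(f)`. -/
def rSeq (f : ℝ → ℝ) (d k : ℕ) : ℂ :=
  2 * (π : ℂ) * (Complex.I * (k : ℂ)) ^ (d + 1) * fourierCoef f k

/-- `q_k^d(z) = ∑_{j=0}^{d+1} (-1)^j binom(d+1, j) r_{k+j} z^{d+1-j}`. -/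
def qPoly (f : ℝ → ℝ) (d k : ℕ) (z : ℂ) : ℂ :=
  ∑ j ∈ Finset.range (d + 2),
    (-1) ^ j * ((d + 1).choose j : ℂ) * rSeq f d (k + j) * z ^ (d + 1 - j)

/-- `w` is a root of `q_k^d` which is closest to the unit circle. -/
def IsRecoveredLocation (f : ℝ → ℝ) (d k : ℕ) (w : ℂ) : Prop :=
  qPoly f d k w = 0 ∧ ∀ z : ℂ, qPoly f d k z = 0 → |‖w‖ - 1| ≤ |‖z‖ - 1|

/-- `a = (Ã_0, …, Ã_d)` solves the linear system
`r_{k+j} w^{-(k+j)} = ∑_{l=0}^{d} (i(k+j))^{d-l} Ã_l`, `j = 0, …, d`. -/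
def SolvesMagnitudeSystem (f : ℝ → ℝ) (d k : ℕ) (w : ℂ) (a : Fin (d + 1) → ℂ) : Prop :=
  ∀ j : Fin (d + 1),
    rSeq f d (k + j) * w ^ (-((k + j : ℕ) : ℤ)) =
      ∑ l : Fin (d + 1), (Complex.I * ((k + j : ℕ) : ℂ)) ^ (d - (l : ℕ)) * a l

end JumpReconstruction

end

/-!
Write `ω = e^{-iξ}` and `m_n = ω^{-n} r_n`. The Fourier coefficients of the periodized Bernoulli
polynomials give `m_n = ∑_{l ≤ d₁} A_l (in)^{d-l} + O(R n^{-d-2})` (`norm_demodulated_sub_le`), the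
error exponent using `d₁ ≥ 2d + 1`. What matters is not only the size of the terms with `l > d` but
their regularity in `n`: every forward difference gains a factor `k^{-1}` on the window
`k ≤ n ≤ k + d + 1`. The predicate `SymbolBound` expresses this; it is stable under products by the
Leibniz rule, and `exists_symbolBound_demodulated` records the resulting expansions of `m_n`.

*Magnitudes.* If `w = ω + O(H k^{-d-2})`, then `r_n w^{-n} = (ω / w)^n m_n`, and `(ω / w)^n - 1` is
a symbol of order `-d-1` (`symbolBound_pow_sub_one`). Hence the data of the linear system differ
from `∑_{l ≤ d} A_l (in)^{d-l}` by a symbol of order `-1` and size `H²`. A polynomial in `n` of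
degree `d` that is a symbol of order `-1` has coefficients `c_j = O(k^{-1-j})`
(`exists_norm_coeff_le`), which is the claimed bound. With zero data the same estimate shows that
the system is injective, hence uniquely solvable.

*Location.* Recentring at `z = ω (1 + y / k)` turns the equation `q(z) = 0` into
`y F(y) + g = 0`, where the coefficients of `F` are normalised differences `Δ^t m_k` with `t ≤ d`
and `g` is a multiple of `k Δ^{d+1} m_k` (`sum_shift_eq_sum_fwdDiff`, `qPoly_eq_zero_iff`). The
coefficients of `F` are within `O(H / k)` of those of the associated Laguerre polynomial
`(D - 1)^{d+1} X^d`, while `g = O(H k^{-d-1})` (`exists_scaledCoeff_bounds`). The Laguerre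
polynomial has no root on the imaginary axis: if the roots of `p` lie in `Re ≥ 0`, then
`Re (p' / p) ≤ 0` on `Re ≤ 0` away from the roots of `p`, so `p' - p` vanishes in `Re ≤ 0` only at
roots of `p`; an imaginary root of `(D - 1)^{d+1} X^d` would therefore be a root of all derivatives
of `X^d` (`eval_laguerreIter_ne_zero`). By compactness `F` is bounded below on bounded sets near the
imaginary axis, so a root `y` is either `O(|g|)` or away from that axis; the product of all roots
being `O(|g|)`, the first case occurs (`exists_perturbed_root_bounds`). Roots of the second kind
give points `z` at distance of order `1 / k` from the unit circle, those of the first kind satisfy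
`z - ω = O(H k^{-d-2})`, so the root closest to the circle is of the first kind
(`exists_location_bound`).
-/

namespace JumpReconstruction

/-! ### Fourier coefficients of the singular part -/

lemma jumpPoint_ne_zero (ξ : ℝ) : jumpPoint ξ ≠ 0 := Complex.exp_ne_zero _

lemma norm_jumpPoint (ξ : ℝ) : ‖jumpPoint ξ‖ = 1 := by
  simp [jumpPoint, Complex.norm_exp]

lemma integral_bernoulliFun_mul_exp (n k : ℕ) :
    ∫ s in (0 : ℝ)..1, (bernoulliFun (n + 1) s : ℂ) *
        Complex.exp (-(2 * π * Complex.I * (k : ℂ) * (s : ℂ))) =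
      -((n + 1).factorial : ℂ) / (2 * π * Complex.I * k) ^ (n + 1) := by
  have h := bernoulliFourierCoeff_eq (Nat.succ_ne_zero n) (k : ℤ)
  rw [bernoulliFourierCoeff, fourierCoeffOn_eq_integral] at h
  simp only [Nat.succ_eq_add_one, Int.cast_natCast] at h
  rw [← h]
  simp only [fourier_coe_apply, sub_zero, div_one, one_smul, smul_eq_mul]
  refine intervalIntegral.integral_congr fun s _ => ?_
  rw [mul_comm]
  congr 2
  push_cast
  ring

lemma periodic_exp (k : ℕ) : Function.Periodic
    (fun t : ℝ => Complex.exp (-(Complex.I * (k : ℂ) * (t : ℂ)))) (2 * π) := by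
  intro t
  simp only
  have : -(Complex.I * (k : ℂ) * ((t + 2 * π : ℝ) : ℂ)) =
      -(Complex.I * (k : ℂ) * (t : ℂ)) - (k : ℂ) * (2 * π * Complex.I) := by
    push_cast; ring
  rw [this, Complex.exp_sub, Complex.exp_nat_mul_two_pi_mul_I, div_one]

lemma periodic_bernoulliV (n : ℕ) (ξ : ℝ) : Function.Periodic (bernoulliV n ξ) (2 * π) := by
  intro t
  have h : (t + 2 * π - ξ) / (2 * π) = (t - ξ) / (2 * π) + 1 := by
    field_simp
    ring
  simp only [bernoulliV, h, Int.fract_add_one]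

lemma bernoulliV_comp_affine (n : ℕ) (ξ : ℝ) {s : ℝ} (hs : s ∈ Ioo (0 : ℝ) 1) :
    bernoulliV n ξ (2 * π * s + ξ) =
      -((2 * π) ^ n / ((n + 1).factorial : ℝ)) * bernoulliFun (n + 1) s := by
  have h : (2 * π * s + ξ - ξ) / (2 * π) = s := by
    field_simp
    ring
  rw [bernoulliV, h, Int.fract_eq_self.2 ⟨hs.1.le, hs.2⟩]

lemma intervalIntegrable_bernoulliV (n : ℕ) (ξ a b : ℝ) :
    IntervalIntegrable (bernoulliV n ξ) MeasureTheory.volume a b := by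
  refine (periodic_bernoulliV n ξ).intervalIntegrable (by positivity) (t := ξ) ?_ a b
  have hc : Continuous fun x : ℝ => -((2 * π) ^ n / ((n + 1).factorial : ℝ)) *
      bernoulliFun (n + 1) ((x - ξ) / (2 * π)) :=
    continuous_const.mul ((continuous_bernoulliFun _).comp (by fun_prop))
  refine (hc.intervalIntegrable ξ (ξ + 2 * π)).congr_uIoo fun x hx => ?_
  have hp := Real.pi_pos
  rw [uIoo_of_le (by linarith)] at hx
  have h0 : 0 ≤ (x - ξ) / (2 * π) := div_nonneg (by linarith [hx.1]) (by positivity)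
  have h1 : (x - ξ) / (2 * π) < 1 := by
    rw [div_lt_one (by positivity)]; linarith [hx.2]
  simp only [bernoulliV, Int.fract_eq_self.2 ⟨h0, h1⟩]

lemma fourierCoef_bernoulliV (n : ℕ) (ξ : ℝ) {k : ℕ} (hk : k ≠ 0) :
    2 * (π : ℂ) * fourierCoef (bernoulliV n ξ) k =
      jumpPoint ξ ^ k / (Complex.I * k) ^ (n + 1) := by
  have hπ : (π : ℂ) ≠ 0 := by exact_mod_cast Real.pi_ne_zero
  have hk' : (k : ℂ) ≠ 0 := by exact_mod_cast hk
  set F : ℝ → ℂ := fun t =>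
    (bernoulliV n ξ t : ℂ) * Complex.exp (-(Complex.I * (k : ℂ) * (t : ℂ))) with hF
  have hper : Function.Periodic F (2 * π) := fun t => by
    have h1 := periodic_bernoulliV n ξ t
    have h2 := periodic_exp k t
    simp only [hF] at h2 ⊢
    rw [h1, h2]
  have hshift : ∫ t in (-π)..π, F t = ∫ t in (2 * π * 0 + ξ)..(2 * π * 1 + ξ), F t := by
    have h := hper.intervalIntegral_add_eq (-π) ξ
    rw [show -π + 2 * π = π by ring] at h
    rw [h]
    congr 1 <;> ring
  have hsub := intervalIntegral.smul_integral_comp_mul_add (a := 0) (b := 1) F (2 * π) ξ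
  have hcongr : ∫ s in (0 : ℝ)..1, F (2 * π * s + ξ) = ∫ s in (0 : ℝ)..1,
      (-((2 * π) ^ n / ((n + 1).factorial : ℂ)) * jumpPoint ξ ^ k) *
      ((bernoulliFun (n + 1) s : ℂ) *
        Complex.exp (-(2 * π * Complex.I * (k : ℂ) * (s : ℂ)))) := by
    refine intervalIntegral.integral_congr_Ioo_of_le zero_le_one fun s hs => ?_
    simp only [hF]
    rw [bernoulliV_comp_affine n ξ hs, jumpPoint, ← Complex.exp_nat_mul]
    have : -(Complex.I * (k : ℂ) * ((2 * π * s + ξ : ℝ) : ℂ)) =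
        (k : ℂ) * -(Complex.I * ξ) + -(2 * π * Complex.I * (k : ℂ) * (s : ℂ)) := by
      push_cast; ring
    rw [this, Complex.exp_add]
    push_cast
    ring
  rw [hcongr, intervalIntegral.integral_const_mul, integral_bernoulliFun_mul_exp] at hsub
  have hfac : ((n + 1).factorial : ℂ) ≠ 0 := by exact_mod_cast Nat.factorial_ne_zero _
  rw [fourierCoef, hshift, ← hsub, Complex.real_smul]
  push_cast
  rw [mul_pow, mul_pow, mul_pow, mul_pow]
  field_simp [Complex.I_ne_zero]
  ring

lemma IsSingleJump.intervalIntegrable {f : ℝ → ℝ} {ξ : ℝ} {d₁ : ℕ} {A : ℕ → ℝ}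
    (hf : IsSingleJump f ξ d₁ A) (a b : ℝ) :
    IntervalIntegrable f MeasureTheory.volume a b := by
  refine hf.periodic.intervalIntegrable (by positivity) (t := ξ) ?_ a b
  obtain ⟨right, left, hr, hl, -⟩ := hf.jump 0 (Nat.zero_le _)
  simp only [iteratedDeriv_zero] at hr hl
  have hp := Real.pi_pos
  have hl' : Tendsto f (𝓝[<] (ξ + 2 * π)) (𝓝 left) := by
    have h1 : Tendsto (fun x => x - 2 * π) (𝓝[<] (ξ + 2 * π)) (𝓝[<] ξ) := by
      refine tendsto_nhdsWithin_iff.2 ⟨?_, ?_⟩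
      · have : Tendsto (fun x : ℝ => x - 2 * π) (𝓝 (ξ + 2 * π)) (𝓝 (ξ + 2 * π - 2 * π)) :=
          (continuous_id.sub continuous_const).tendsto _
        rw [add_sub_cancel_right] at this
        exact this.mono_left nhdsWithin_le_nhds
      · filter_upwards [self_mem_nhdsWithin] with x hx
        simp only [mem_Iio] at hx ⊢
        linarith
    refine (hl.comp h1).congr fun x => ?_
    simpa using hf.periodic.sub_eq x
  have hc := continuousOn_Icc_extendFrom_Ioo hf.contDiffOn.continuousOn hr hl'
  have hle : ξ ≤ ξ + 2 * π := by linarith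
  have hi : IntervalIntegrable (extendFrom (Ioo ξ (ξ + 2 * π)) f) MeasureTheory.volume
      ξ (ξ + 2 * π) := ContinuousOn.intervalIntegrable (by rwa [uIcc_of_le hle])
  refine hi.congr_uIoo fun x hx => ?_
  rw [uIoo_of_le hle] at hx
  exact extendFrom_extends hf.contDiffOn.continuousOn x hx

lemma intervalIntegrable_mul_exp {g : ℝ → ℝ} {a b : ℝ} (k : ℕ)
    (hg : IntervalIntegrable g MeasureTheory.volume a b) :
    IntervalIntegrable
      (fun t : ℝ => (g t : ℂ) * Complex.exp (-(Complex.I * (k : ℂ) * (t : ℂ))))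
      MeasureTheory.volume a b :=
  IntervalIntegrable.mul_continuousOn ⟨hg.1.ofReal, hg.2.ofReal⟩
    (Continuous.continuousOn (by fun_prop))

lemma fourierCoef_sub_singularPart {f : ℝ → ℝ} {ξ : ℝ} {d₁ : ℕ} {A : ℕ → ℝ}
    (hf : IsSingleJump f ξ d₁ A) (k : ℕ) :
    fourierCoef (fun x => f x - singularPart ξ A d₁ x) k =
      fourierCoef f k - ∑ l ∈ Finset.range (d₁ + 1), A l * fourierCoef (bernoulliV l ξ) k := by
  have h1 := intervalIntegrable_mul_exp k (hf.intervalIntegrable (-π) π)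
  have h2 := fun l => intervalIntegrable_mul_exp k (intervalIntegrable_bernoulliV l ξ (-π) π)
  have h3 : ∀ l ∈ Finset.range (d₁ + 1), IntervalIntegrable (fun t : ℝ => (A l : ℂ) *
      ((bernoulliV l ξ t : ℂ) * Complex.exp (-(Complex.I * (k : ℂ) * (t : ℂ)))))
      MeasureTheory.volume (-π) π := fun l _ => (h2 l).const_mul _
  have key : ∫ t in (-π)..π, ((f t - singularPart ξ A d₁ t : ℝ) : ℂ) *
        Complex.exp (-(Complex.I * (k : ℂ) * (t : ℂ))) =
      (∫ t in (-π)..π, (f t : ℂ) * Complex.exp (-(Complex.I * (k : ℂ) * (t : ℂ)))) -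
      ∑ l ∈ Finset.range (d₁ + 1), (A l : ℂ) * ∫ t in (-π)..π,
        (bernoulliV l ξ t : ℂ) * Complex.exp (-(Complex.I * (k : ℂ) * (t : ℂ))) := by
    simp_rw [← intervalIntegral.integral_const_mul]
    rw [← intervalIntegral.integral_finsetSum h3, ← intervalIntegral.integral_sub h1]
    · refine intervalIntegral.integral_congr fun t _ => ?_
      simp only [singularPart]
      push_cast
      rw [sub_mul, Finset.sum_mul]
      simp only [mul_assoc]
    · simpa only [Finset.sum_fn] using IntervalIntegrable.sum _ h3
  simp only [fourierCoef]
  rw [key, mul_sub, Finset.mul_sum]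
  congr 1
  exact Finset.sum_congr rfl fun l _ => by ring

/-- The normalised measurement `ω^{-n} r_n`, i.e. `r_n` with the oscillation caused by the
jump location removed. -/
noncomputable def demodulated (f : ℝ → ℝ) (ξ : ℝ) (d n : ℕ) : ℂ :=
  rSeq f d n * (jumpPoint ξ ^ n)⁻¹

lemma rSeq_eq_mul_demodulated (f : ℝ → ℝ) (ξ : ℝ) (d n : ℕ) :
    rSeq f d n = jumpPoint ξ ^ n * demodulated f ξ d n := by
  rw [demodulated]
  field_simp [pow_ne_zero n (jumpPoint_ne_zero ξ)]

/-- The demodulated measurements are a Laurent polynomial in `n` carrying the jump magnitudes,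
up to the contribution of the smooth part. -/
lemma norm_demodulated_sub_le {f : ℝ → ℝ} {ξ : ℝ} {d d₁ : ℕ} {A : ℕ → ℝ} {R : ℝ}
    (hf : IsSingleJump f ξ d₁ A) (hR : SmoothPartBound f ξ d₁ A R) {n : ℕ} (hn : 1 ≤ n) :
    ‖demodulated f ξ d n -
        ∑ l ∈ Finset.range (d₁ + 1), (A l : ℂ) * (Complex.I * n) ^ ((d : ℤ) - l)‖ ≤
      2 * π * R * (n : ℝ) ^ ((d : ℤ) - d₁ - 1) := by
  have hn0 : n ≠ 0 := by omega
  have hnC : (Complex.I * (n : ℂ)) ≠ 0 :=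
    mul_ne_zero Complex.I_ne_zero (by exact_mod_cast hn0)
  have hnR : (n : ℝ) ≠ 0 := by exact_mod_cast hn0
  have hω : jumpPoint ξ ^ n ≠ 0 := pow_ne_zero n (jumpPoint_ne_zero ξ)
  have h := hR n hn
  rw [fourierCoef_sub_singularPart hf] at h
  have heq : demodulated f ξ d n -
        ∑ l ∈ Finset.range (d₁ + 1), (A l : ℂ) * (Complex.I * n) ^ ((d : ℤ) - l) =
      2 * π * (Complex.I * n) ^ (d + 1) * (jumpPoint ξ ^ n)⁻¹ * (fourierCoef f n -
        ∑ l ∈ Finset.range (d₁ + 1), A l * fourierCoef (bernoulliV l ξ) n) := by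
    rw [demodulated, rSeq, mul_sub, Finset.mul_sum]
    congr 1
    · ring
    · refine Finset.sum_congr rfl fun l _ => ?_
      have hb := fourierCoef_bernoulliV l ξ hn0
      have e : (Complex.I * (n : ℂ)) ^ ((d : ℤ) - l) =
          (Complex.I * n) ^ (d + 1) / (Complex.I * n) ^ (l + 1) := by
        rw [show (d : ℤ) - l = ((d + 1 : ℕ) : ℤ) - ((l + 1 : ℕ) : ℤ) by push_cast; ring,
          zpow_sub₀ hnC, zpow_natCast, zpow_natCast]
      rw [e]
      calc (A l : ℂ) * ((Complex.I * n) ^ (d + 1) / (Complex.I * n) ^ (l + 1))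
          = (A l : ℂ) * (Complex.I * n) ^ (d + 1) * (jumpPoint ξ ^ n)⁻¹ *
            (jumpPoint ξ ^ n / (Complex.I * n) ^ (l + 1)) := by field_simp
        _ = _ := by rw [← hb]; ring
  rw [heq, norm_mul]
  have hnorm : ‖2 * (π : ℂ) * (Complex.I * n) ^ (d + 1) * (jumpPoint ξ ^ n)⁻¹‖ =
      2 * π * (n : ℝ) ^ (d + 1) := by
    simp [norm_jumpPoint, abs_of_pos Real.pi_pos]
  rw [hnorm]
  calc 2 * π * (n : ℝ) ^ (d + 1) * _ ≤ 2 * π * (n : ℝ) ^ (d + 1) *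
        (R * (n : ℝ) ^ (-(d₁ : ℤ) - 2)) := by gcongr
    _ = 2 * π * R * ((n : ℝ) ^ ((d + 1 : ℕ) : ℤ) * (n : ℝ) ^ (-(d₁ : ℤ) - 2)) := by
        rw [zpow_natCast]; ring
    _ = _ := by
        rw [← zpow_add₀ hnR]
        congr 2
        push_cast
        ring

/-! ### Difference calculus -/

/-- `g` behaves like a symbol of order `a` on the window `[k, k + N]`: each forward difference
that only involves values in the window gains a factor `k⁻¹`. -/
def SymbolBound (N k : ℕ) (a : ℤ) (M : ℝ) (g : ℕ → ℂ) : Prop :=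
  ∀ s n : ℕ, k ≤ n → n + s ≤ k + N → ‖((fwdDiff 1)^[s] g) n‖ ≤ M * (k : ℝ) ^ (a - s)

lemma fwdDiff_iter_congr {g h : ℕ → ℂ} {s n : ℕ} (H : ∀ i, n ≤ i → i ≤ n + s → g i = h i) :
    ((fwdDiff 1)^[s] g) n = ((fwdDiff 1)^[s] h) n := by
  rw [fwdDiff_iter_eq_sum_shift, fwdDiff_iter_eq_sum_shift]
  refine Finset.sum_congr rfl fun i hi => ?_
  have := Finset.mem_range.1 hi
  rw [H _ (by simp) (by simp; omega)]

lemma norm_fwdDiff_iter_le {g : ℕ → ℂ} {B : ℝ} (s : ℕ) : ∀ n,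
    (∀ i, n ≤ i → i ≤ n + s → ‖g i‖ ≤ B) → ‖((fwdDiff 1)^[s] g) n‖ ≤ 2 ^ s * B := by
  induction s with
  | zero => intro n h; simpa using h n le_rfl (by simp)
  | succ s ih =>
    intro n h
    rw [Function.iterate_succ_apply', fwdDiff]
    have h1 := ih (n + 1) fun i h1 h2 => h i (by omega) (by omega)
    have h2 := ih n fun i h1 h2 => h i (by omega) (by omega)
    calc _ ≤ _ := norm_sub_le _ _
      _ ≤ 2 ^ s * B + 2 ^ s * B := add_le_add h1 h2
      _ = _ := by ring

lemma SymbolBound.congr {N k : ℕ} {a : ℤ} {M : ℝ} {g h : ℕ → ℂ} (hg : SymbolBound N k a M g)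
    (H : ∀ i, k ≤ i → i ≤ k + N → g i = h i) : SymbolBound N k a M h := by
  intro s n h1 h2
  rw [← fwdDiff_iter_congr (g := g) fun i h3 h4 => H i (by omega) (by omega)]
  exact hg s n h1 h2

lemma SymbolBound.add {N k : ℕ} {a : ℤ} {M M' : ℝ} {g h : ℕ → ℂ} (hg : SymbolBound N k a M g)
    (hh : SymbolBound N k a M' h) : SymbolBound N k a (M + M') (g + h) := by
  intro s n h1 h2
  rw [fwdDiff_iter_add, Pi.add_apply, add_mul]
  exact (norm_add_le _ _).trans (add_le_add (hg s n h1 h2) (hh s n h1 h2))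

lemma SymbolBound.const_mul {N k : ℕ} {a : ℤ} {M : ℝ} {g : ℕ → ℂ} (hg : SymbolBound N k a M g)
    (c : ℂ) : SymbolBound N k a (‖c‖ * M) (fun n => c * g n) := by
  intro s n h1 h2
  have : (fun n => c * g n) = c • g := rfl
  rw [this, fwdDiff_iter_const_smul, Pi.smul_apply, smul_eq_mul, norm_mul, mul_assoc]
  exact mul_le_mul_of_nonneg_left (hg s n h1 h2) (norm_nonneg c)

lemma SymbolBound.sum {ι : Type*} {N k : ℕ} {a : ℤ} {S : Finset ι} {M : ι → ℝ}
    {g : ι → ℕ → ℂ} (hg : ∀ i ∈ S, SymbolBound N k a (M i) (g i)) :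
    SymbolBound N k a (∑ i ∈ S, M i) (fun n => ∑ i ∈ S, g i n) := by
  intro s n h1 h2
  have : (fun n => ∑ i ∈ S, g i n) = ∑ i ∈ S, g i := by ext; simp
  rw [this, fwdDiff_iter_finsetSum, Finset.sum_apply, Finset.sum_mul]
  exact norm_sum_le_of_le _ fun i hi => hg i hi s n h1 h2

lemma SymbolBound.mono {N N' k : ℕ} {a b : ℤ} {M M' : ℝ} {g : ℕ → ℂ}
    (hg : SymbolBound N k a M g) (hk : 1 ≤ k) (hN : N' ≤ N) (hab : a ≤ b) (hM : M ≤ M')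
    (hM' : 0 ≤ M') : SymbolBound N' k b M' g := by
  intro s n h1 h2
  have hk' : (1 : ℝ) ≤ k := by exact_mod_cast hk
  refine (hg s n h1 (by omega)).trans ?_
  exact mul_le_mul hM (zpow_le_zpow_right₀ hk' (by omega)) (by positivity) hM'

lemma SymbolBound.forwardDiff {N k : ℕ} {a : ℤ} {M : ℝ} {g : ℕ → ℂ}
    (hg : SymbolBound (N + 1) k a M g) : SymbolBound N k (a - 1) M (fwdDiff 1 g) := by
  intro s n h1 h2
  have := hg (s + 1) n h1 (by omega)
  rw [Function.iterate_succ_apply] at this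
  rwa [show a - 1 - (s : ℤ) = a - ((s + 1 : ℕ) : ℤ) by push_cast; ring]

lemma SymbolBound.shift {N k : ℕ} {a : ℤ} {M : ℝ} {g : ℕ → ℂ}
    (hg : SymbolBound (N + 1) k a M g) : SymbolBound N k a M (fun n => g (n + 1)) := by
  intro s n h1 h2
  rw [fwdDiff_iter_comp_add]
  exact hg s (n + 1) (by omega) (by omega)

lemma fwdDiff_mul (f g : ℕ → ℂ) :
    fwdDiff 1 (f * g) = (fwdDiff 1 f) * (fun n => g (n + 1)) + f * (fwdDiff 1 g) := by
  ext n
  simp only [fwdDiff, Pi.mul_apply, Pi.add_apply]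
  ring

lemma norm_fwdDiff_iter_mul_le {k : ℕ} (hk : 1 ≤ k) {M M' : ℝ} (s : ℕ) :
    ∀ (N : ℕ) (a b : ℤ) (f g : ℕ → ℂ), SymbolBound N k a M f → SymbolBound N k b M' g →
    ∀ n, k ≤ n → n + s ≤ k + N →
      ‖((fwdDiff 1)^[s] (f * g)) n‖ ≤ 2 ^ s * (M * M') * (k : ℝ) ^ (a + b - s) := by
  have hk0 : (k : ℝ) ≠ 0 := by positivity
  induction s with
  | zero =>
    intro N a b f g hf hg n h1 h2
    have hf' := hf 0 n h1 (by omega)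
    have hg' := hg 0 n h1 (by omega)
    simp only [Function.iterate_zero, id_eq, Nat.cast_zero, sub_zero] at hf' hg'
    simp only [Function.iterate_zero, id_eq, Nat.cast_zero, sub_zero, Pi.mul_apply, norm_mul,
      pow_zero, one_mul, zpow_add₀ hk0]
    calc ‖f n‖ * ‖g n‖ ≤ (M * (k : ℝ) ^ a) * (M' * (k : ℝ) ^ b) :=
          mul_le_mul hf' hg' (norm_nonneg _) ((norm_nonneg _).trans hf')
      _ = _ := by ring
  | succ s ih =>
    intro N a b f g hf hg n h1 h2
    obtain ⟨N, rfl⟩ : ∃ N', N = N' + 1 := ⟨N - 1, by omega⟩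
    have hr : ∀ {c : ℤ} {B : ℝ} {u : ℕ → ℂ}, SymbolBound (N + 1) k c B u →
        SymbolBound N k c B u := fun h s n h1 h2 => h s n h1 (by omega)
    have e1 := ih N _ _ _ _ hf.forwardDiff hg.shift n h1 (by omega)
    have e2 := ih N _ _ _ _ (hr hf) hg.forwardDiff n h1 (by omega)
    rw [Function.iterate_succ_apply, fwdDiff_mul, fwdDiff_iter_add, Pi.add_apply]
    rw [show a - 1 + b - (s : ℤ) = a + b - ((s + 1 : ℕ) : ℤ) by push_cast; ring] at e1
    rw [show a + (b - 1) - (s : ℤ) = a + b - ((s + 1 : ℕ) : ℤ) by push_cast; ring] at e2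
    calc _ ≤ _ := norm_add_le _ _
      _ ≤ _ := add_le_add e1 e2
      _ = _ := by rw [pow_succ]; ring

lemma SymbolBound.mul {N k : ℕ} {a b : ℤ} {M M' : ℝ} {f g : ℕ → ℂ} (hk : 1 ≤ k) (hM : 0 ≤ M)
    (hM' : 0 ≤ M') (hf : SymbolBound N k a M f) (hg : SymbolBound N k b M' g) :
    SymbolBound N k (a + b) (2 ^ N * (M * M')) (f * g) := by
  intro s n h1 h2
  refine (norm_fwdDiff_iter_mul_le hk s N a b f g hf hg n h1 h2).trans ?_
  gcongr
  · norm_num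
  · omega

lemma symbolBound_of_norm_le {N k : ℕ} (hk : 1 ≤ k) {a : ℤ} {M : ℝ} (hM : 0 ≤ M) {g : ℕ → ℂ}
    (hg : ∀ n, k ≤ n → n ≤ k + N → ‖g n‖ ≤ M * (k : ℝ) ^ (a - N)) :
    SymbolBound N k a (2 ^ N * M) g := by
  intro s n h1 h2
  have hk' : (1 : ℝ) ≤ k := by exact_mod_cast hk
  refine (norm_fwdDiff_iter_le s n fun i h3 h4 => hg i (by omega) (by omega)).trans ?_
  rw [← mul_assoc]
  gcongr
  · norm_num
  · omega
  · omega

lemma symbolBound_one (N k : ℕ) : SymbolBound N k 0 1 (fun _ => 1) := by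
  intro s n _ _
  cases s with
  | zero => simp
  | succ s =>
    have : ∀ s, (fwdDiff 1)^[s] (fun _ : ℕ => (0 : ℂ)) = fun _ => 0 := by
      intro s
      induction s with
      | zero => rfl
      | succ s ih => rw [Function.iterate_succ_apply, fwdDiff_const, ih]
    rw [Function.iterate_succ_apply, fwdDiff_const, this]
    simp only [norm_zero]
    positivity

lemma symbolBound_natCast {N k : ℕ} (hk : 1 ≤ k) :
    SymbolBound N k 1 (N + 1) (fun n => (n : ℂ)) := by
  intro s n h1 h2
  have hk' : (1 : ℝ) ≤ k := by exact_mod_cast hk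
  match s with
  | 0 =>
    simp only [Function.iterate_zero, id_eq, Complex.norm_natCast, Nat.cast_zero, sub_zero,
      zpow_one]
    have : (n : ℝ) ≤ k + N := by exact_mod_cast (by omega : n ≤ k + N)
    nlinarith
  | s + 1 =>
    have h : fwdDiff 1 (fun n : ℕ => (n : ℂ)) = fun _ => 1 := by
      ext n; simp [fwdDiff]
    have h0 := symbolBound_one N k s n h1 (by omega)
    rw [Function.iterate_succ_apply, h]
    refine h0.trans ?_
    rw [show (1 : ℤ) - ((s + 1 : ℕ) : ℤ) = 0 - s by push_cast; ring]
    gcongr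
    linarith [(Nat.cast_nonneg N : (0 : ℝ) ≤ N)]

lemma fwdDiff_iter_inv (s n : ℕ) (hn : 1 ≤ n) :
    ((fwdDiff 1)^[s] (fun n : ℕ => (n : ℂ)⁻¹)) n =
      (-1) ^ s * s.factorial / ∏ i ∈ Finset.range (s + 1), ((n : ℂ) + i) := by
  induction s generalizing n with
  | zero => simp
  | succ s ih =>
    rw [Function.iterate_succ_apply', fwdDiff, ih n hn, ih (n + 1) (by omega)]
    have hne : ∀ m : ℕ, ((n : ℂ) + m) ≠ 0 := fun m => by exact_mod_cast (by omega : n + m ≠ 0)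
    have hP : ∏ i ∈ Finset.range s, ((n : ℂ) + ((i + 1 : ℕ) : ℂ)) ≠ 0 :=
      Finset.prod_ne_zero_iff.2 fun i _ => hne _
    have e1 : ∏ i ∈ Finset.range (s + 1), (((n + 1 : ℕ) : ℂ) + i) =
        (∏ i ∈ Finset.range s, ((n : ℂ) + ((i + 1 : ℕ) : ℂ))) * (n + ((s + 1 : ℕ) : ℂ)) := by
      rw [Finset.prod_range_succ]
      congr 1
      · exact Finset.prod_congr rfl fun i _ => by push_cast; ring
      · push_cast; ring
    have e2 : ∏ i ∈ Finset.range (s + 1), ((n : ℂ) + i) =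
        (∏ i ∈ Finset.range s, ((n : ℂ) + ((i + 1 : ℕ) : ℂ))) * n := by
      rw [Finset.prod_range_succ']; simp
    have e3 : ∏ i ∈ Finset.range (s + 1 + 1), ((n : ℂ) + i) =
        (∏ i ∈ Finset.range s, ((n : ℂ) + ((i + 1 : ℕ) : ℂ))) * (n + ((s + 1 : ℕ) : ℂ)) * n := by
      rw [Finset.prod_range_succ', Finset.prod_range_succ]; simp
    rw [e1, e2, e3]
    generalize ∏ i ∈ Finset.range s, ((n : ℂ) + ((i + 1 : ℕ) : ℂ)) = P at hP ⊢
    have h0 : (n : ℂ) ≠ 0 := by simpa using hne 0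
    have h1 := hne (s + 1)
    rw [Nat.factorial_succ]
    push_cast at h1 ⊢
    field_simp
    ring

lemma symbolBound_inv {N k : ℕ} (hk : 1 ≤ k) :
    SymbolBound N k (-1) N.factorial (fun n => (n : ℂ)⁻¹) := by
  intro s n h1 h2
  have hk' : (1 : ℝ) ≤ k := by exact_mod_cast hk
  rw [fwdDiff_iter_inv s n (by omega), norm_div, norm_prod, norm_mul, norm_pow, norm_neg,
    norm_one, one_pow, one_mul, Complex.norm_natCast]
  have hprod : (k : ℝ) ^ (s + 1) ≤ ∏ i ∈ Finset.range (s + 1), ‖(n : ℂ) + i‖ := by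
    calc (k : ℝ) ^ (s + 1) = ∏ _i ∈ Finset.range (s + 1), (k : ℝ) := by simp
      _ ≤ _ := by
        refine Finset.prod_le_prod (fun _ _ => by positivity) fun i _ => ?_
        rw [← Nat.cast_add, Complex.norm_natCast]
        exact_mod_cast (by omega : k ≤ n + i)
  rw [show (-1 : ℤ) - s = -((s + 1 : ℕ) : ℤ) by push_cast; ring, zpow_neg, zpow_natCast,
    ← div_eq_mul_inv]
  gcongr
  omega

/-- Powers `n ↦ n ^ a` are symbols of order `a`, with a constant uniform in the window's
position. -/
lemma exists_symbolBound_zpow (N : ℕ) (a : ℤ) : ∃ M : ℝ, 0 ≤ M ∧ ∀ k : ℕ, 1 ≤ k →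
    SymbolBound N k a M (fun n => (n : ℂ) ^ a) := by
  have key : ∀ (e : ℤ) (M₁ : ℝ) (u : ℕ → ℂ), 0 ≤ M₁ →
      (∀ k : ℕ, 1 ≤ k → SymbolBound N k e M₁ u) → ∀ j : ℕ, ∃ M : ℝ, 0 ≤ M ∧ ∀ k : ℕ, 1 ≤ k →
        SymbolBound N k (e * j) M (fun n => u n ^ j) := by
    intro e M₁ u hM₁ hu j
    induction j with
    | zero => exact ⟨1, zero_le_one, fun k _ => by simpa using symbolBound_one N k⟩
    | succ j ih =>
      obtain ⟨M, hM, h⟩ := ih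
      refine ⟨2 ^ N * (M * M₁), by positivity, fun k hk => ?_⟩
      have := (h k hk).mul hk hM hM₁ (hu k hk)
      rw [show e * ((j + 1 : ℕ) : ℤ) = e * j + e by push_cast; ring]
      exact this.congr fun i _ _ => (pow_succ (u i) j).symm
  obtain ⟨j, rfl | rfl⟩ := Int.eq_nat_or_neg a
  · obtain ⟨M, hM, h⟩ := key 1 _ _ (by positivity) (fun k hk => symbolBound_natCast hk) j
    exact ⟨M, hM, fun k hk => by simpa using h k hk⟩
  · obtain ⟨M, hM, h⟩ := key (-1) _ _ (by positivity) (fun k hk => symbolBound_inv hk) j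
    exact ⟨M, hM, fun k hk => by simpa using h k hk⟩

/-! ### Recovering polynomial coefficients from a symbol bound -/

lemma fwdDiff_iter_comp_natCast (g : ℂ → ℂ) (s n : ℕ) :
    ((fwdDiff 1)^[s] (fun n : ℕ => g n)) n = ((fwdDiff 1)^[s] g) (n : ℂ) := by
  simp [fwdDiff_iter_eq_sum_shift]

lemma fwdDiff_iter_sum_pow (c : ℕ → ℂ) (D n : ℕ) :
    ((fwdDiff 1)^[D] (fun n : ℕ => ∑ j ∈ Finset.range (D + 1), c j * (n : ℂ) ^ j)) n =
      c D * D.factorial := by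
  have e : (fun z : ℂ => ∑ j ∈ Finset.range (D + 1), c j * z ^ j) =
      (fun z : ℂ => ∑ j ∈ Finset.range D, c j * z ^ j) + c D • fun z : ℂ => z ^ D := by
    ext z; simp [Finset.sum_range_succ]
  rw [fwdDiff_iter_comp_natCast (fun z => ∑ j ∈ Finset.range (D + 1), c j * z ^ j), e,
    fwdDiff_iter_add, fwdDiff_iter_const_smul, fwdDiff_iter_sum_mul_pow_eq_zero,
    fwdDiff_iter_eq_factorial]
  simp

/-- A polynomial of degree `D` which is a symbol of order `-1` on a window with `D + 1` points
has coefficients of size `k^{-1-j}`: the top difference bounds the leading coefficient, and the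
leading term may then be subtracted. -/
lemma exists_norm_coeff_le (D : ℕ) : ∃ C : ℝ, 0 ≤ C ∧ ∀ (k : ℕ) (M : ℝ) (c : ℕ → ℂ), 1 ≤ k →
    0 ≤ M → SymbolBound D k (-1) M (fun n => ∑ j ∈ Finset.range (D + 1), c j * (n : ℂ) ^ j) →
    ∀ j ≤ D, ‖c j‖ ≤ C * M * (k : ℝ) ^ (-1 - (j : ℤ)) := by
  have top : ∀ (D k : ℕ) (M : ℝ) (c : ℕ → ℂ),
      SymbolBound D k (-1) M (fun n => ∑ j ∈ Finset.range (D + 1), c j * (n : ℂ) ^ j) →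
      ‖c D‖ ≤ M * (k : ℝ) ^ (-1 - (D : ℤ)) := by
    intro D k M c h
    have h1 := h D k le_rfl le_rfl
    rw [fwdDiff_iter_sum_pow, norm_mul, Complex.norm_natCast] at h1
    refine le_trans ?_ h1
    exact le_mul_of_one_le_right (norm_nonneg _) (by exact_mod_cast Nat.factorial_pos D)
  induction D with
  | zero =>
    refine ⟨1, zero_le_one, fun k M c hk hM h j hj => ?_⟩
    obtain rfl : j = 0 := by omega
    simpa using top 0 k M c h
  | succ D ih =>
    obtain ⟨C, hC, ih⟩ := ih
    obtain ⟨B, hB, hpow⟩ := exists_symbolBound_zpow D ((D + 1 : ℕ) : ℤ)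
    refine ⟨C * (1 + B) + 1, by positivity, fun k M c hk hM h j hj => ?_⟩
    have hk0 : (0 : ℝ) < k := by exact_mod_cast hk
    have htop := top (D + 1) k M c h
    rcases Nat.lt_or_eq_of_le hj with hj' | rfl
    · have h2 : SymbolBound D k (-1) (M * B) (fun n => -c (D + 1) * (n : ℂ) ^ (D + 1)) := by
        intro s n h1 h2
        refine ((hpow k hk).const_mul (-c (D + 1)) s n h1 h2).trans ?_
        rw [norm_neg]
        calc ‖c (D + 1)‖ * B * (k : ℝ) ^ (((D + 1 : ℕ) : ℤ) - s)
            ≤ (M * (k : ℝ) ^ (-1 - ((D + 1 : ℕ) : ℤ))) * B *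
              (k : ℝ) ^ (((D + 1 : ℕ) : ℤ) - s) := by gcongr
          _ = M * B * ((k : ℝ) ^ (-1 - ((D + 1 : ℕ) : ℤ)) *
              (k : ℝ) ^ (((D + 1 : ℕ) : ℤ) - s)) := by ring
          _ = _ := by
            rw [← zpow_add₀ hk0.ne']
            congr 2
            ring
      have h3 := (h.mono hk (Nat.le_succ D) le_rfl le_rfl hM).add h2
      have h4 := ih k (M + M * B) c hk (by positivity) (h3.congr fun i _ _ => by
        simp [Finset.sum_range_succ _ (D + 1)]) j (by omega)
      calc _ ≤ _ := h4
        _ = C * (1 + B) * M * (k : ℝ) ^ (-1 - (j : ℤ)) := by ring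
        _ ≤ _ := by gcongr; linarith
    · refine htop.trans ?_
      gcongr
      nlinarith [mul_nonneg hC hB, mul_nonneg (mul_nonneg hC hB) hM, mul_nonneg hC hM]

/-! ### Symbol bounds for the measurements -/

lemma SmoothPartBound.nonneg {f : ℝ → ℝ} {ξ : ℝ} {d₁ : ℕ} {A : ℕ → ℝ} {R : ℝ}
    (hR : SmoothPartBound f ξ d₁ A R) : 0 ≤ R := by
  simpa using (norm_nonneg _).trans (hR 1 le_rfl)

lemma two_le_sizeH {d d₁ : ℕ} {A : ℕ → ℝ} {R : ℝ} (hR : 0 ≤ R) : 2 ≤ sizeH d d₁ A R := by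
  have h1 : (1 : ℝ) ≤ lowJumpSize d A := le_max_left _ _
  have h2 : (1 : ℝ) ≤ highJumpSize d d₁ A := le_max_left _ _
  rw [sizeH]; linarith

lemma sum_abs_add_le_sizeH (d d₁ : ℕ) (A : ℕ → ℝ) (R : ℝ) :
    ∑ l ∈ Finset.range (d + 1), |A l| + ∑ l ∈ Finset.Icc (d + 1) d₁, |A l| + R ≤
      sizeH d d₁ A R := by
  have h1 : ∑ l ∈ Finset.range (d + 1), |A l| ≤ lowJumpSize d A := le_max_right _ _
  have h2 : ∑ l ∈ Finset.Icc (d + 1) d₁, |A l| ≤ highJumpSize d d₁ A := le_max_right _ _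
  rw [sizeH]; linarith

lemma exists_symbolBound_jumpTerm (N d d₁ : ℕ) : ∃ B : ℝ, 0 ≤ B ∧ ∀ (A : ℕ → ℝ) (l k : ℕ),
    l ≤ d₁ → 1 ≤ k → SymbolBound N k ((d : ℤ) - l) (|A l| * B)
      (fun n => (A l : ℂ) * (Complex.I * n) ^ ((d : ℤ) - l)) := by
  choose M hM h using fun l : ℕ => exists_symbolBound_zpow N ((d : ℤ) - l)
  refine ⟨∑ l ∈ Finset.range (d₁ + 1), M l, Finset.sum_nonneg fun l _ => hM l,
    fun A l k hl hk => ?_⟩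
  have h1 := (h l k hk).const_mul ((A l : ℂ) * Complex.I ^ ((d : ℤ) - l))
  rw [norm_mul, norm_zpow, Complex.norm_I, one_zpow, mul_one, Complex.norm_real,
    Real.norm_eq_abs] at h1
  have hle : M l ≤ ∑ l ∈ Finset.range (d₁ + 1), M l :=
    Finset.single_le_sum (fun l _ => hM l) (Finset.mem_range.2 (by omega))
  refine (h1.mono hk le_rfl le_rfl (mul_le_mul_of_nonneg_left hle (abs_nonneg _))
    (mul_nonneg (abs_nonneg _) ((hM l).trans hle))).congr fun i _ _ => ?_
  rw [mul_zpow]; ring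

lemma symbolBound_smoothPart {f : ℝ → ℝ} {ξ : ℝ} {d d₁ : ℕ} {A : ℕ → ℝ} {R : ℝ}
    (hd : 2 * d + 1 ≤ d₁) (hf : IsSingleJump f ξ d₁ A) (hR : SmoothPartBound f ξ d₁ A R)
    {k : ℕ} (hk : 1 ≤ k) :
    SymbolBound (d + 1) k (-1) (2 ^ (d + 1) * (2 * π * R)) (fun n => demodulated f ξ d n -
      ∑ l ∈ Finset.range (d₁ + 1), (A l : ℂ) * (Complex.I * n) ^ ((d : ℤ) - l)) := by
  have hR0 := hR.nonneg
  have hk0 : (0 : ℝ) < k := by exact_mod_cast hk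
  refine symbolBound_of_norm_le hk (by positivity) fun n h1 h2 => ?_
  have hn : (1 : ℝ) ≤ n := by exact_mod_cast hk.trans h1
  refine (norm_demodulated_sub_le hf hR (hk.trans h1)).trans ?_
  refine mul_le_mul_of_nonneg_left ?_ (by positivity)
  calc (n : ℝ) ^ ((d : ℤ) - d₁ - 1) ≤ (n : ℝ) ^ (-((d + 2 : ℕ) : ℤ)) :=
        zpow_le_zpow_right₀ hn (by push_cast; omega)
    _ ≤ (k : ℝ) ^ (-((d + 2 : ℕ) : ℤ)) := by
        rw [zpow_neg, zpow_neg, zpow_natCast, zpow_natCast]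
        gcongr
    _ = _ := by congr 1; push_cast; ring

/-- The demodulated measurements are a symbol of order `d` with principal part `A_0 (in)^d`, and
the jump polynomial `∑_{l ≤ d} A_l (in)^{d-l}` approximates them up to order `-1`. -/
lemma exists_symbolBound_demodulated {d d₁ : ℕ} (hd : 2 * d + 1 ≤ d₁) : ∃ C : ℝ, 0 < C ∧
    ∀ (f : ℝ → ℝ) (ξ : ℝ) (A : ℕ → ℝ) (R : ℝ), IsSingleJump f ξ d₁ A →
      SmoothPartBound f ξ d₁ A R → ∀ k : ℕ, 1 ≤ k →
      SymbolBound (d + 1) k (-1) (C * sizeH d d₁ A R) (fun n => demodulated f ξ d n -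
        ∑ l ∈ Finset.range (d + 1), (A l : ℂ) * (Complex.I * n) ^ (d - l)) ∧
      SymbolBound (d + 1) k ((d : ℤ) - 1) (C * sizeH d d₁ A R)
        (fun n => demodulated f ξ d n - (A 0 : ℂ) * (Complex.I * n) ^ d) ∧
      SymbolBound (d + 1) k d (C * sizeH d d₁ A R) (demodulated f ξ d) := by
  obtain ⟨B, hB, hterm⟩ := exists_symbolBound_jumpTerm (d + 1) d d₁
  set S : ℝ := 2 ^ (d + 1) * (2 * π) with hS
  have hS0 : 0 < S := by positivity
  refine ⟨B + S, by positivity, fun f ξ A R hf hR k hk => ?_⟩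
  have hR0 := hR.nonneg
  have hH := sum_abs_add_le_sizeH d d₁ A R
  have hH2 : 2 ≤ sizeH d d₁ A R := two_le_sizeH hR0
  set H := sizeH d d₁ A R with hHdef
  set lo : ℝ := ∑ l ∈ Finset.range (d + 1), |A l| with hlo
  set hi : ℝ := ∑ l ∈ Finset.Icc (d + 1) d₁, |A l| with hhi
  have hlo0 : 0 ≤ lo := Finset.sum_nonneg fun _ _ => abs_nonneg _
  have hhi0 : 0 ≤ hi := Finset.sum_nonneg fun _ _ => abs_nonneg _
  have hbound : hi * B + S * R + lo * B ≤ (B + S) * H := by nlinarith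
  have hCH : 0 ≤ (B + S) * H := by positivity
  have hsmooth := symbolBound_smoothPart hd hf hR hk
  rw [← mul_assoc, ← hS] at hsmooth
  have hpow : ∀ l ∈ Finset.range (d + 1), ∀ n : ℕ,
      (A l : ℂ) * (Complex.I * n) ^ ((d : ℤ) - l) = (A l : ℂ) * (Complex.I * n) ^ (d - l) := by
    intro l hl n
    have := Finset.mem_range.1 hl
    rw [show (d : ℤ) - l = ((d - l : ℕ) : ℤ) by omega, zpow_natCast]
  have hhigh : SymbolBound (d + 1) k (-1) (hi * B) (fun n => ∑ l ∈ Finset.Icc (d + 1) d₁,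
      (A l : ℂ) * (Complex.I * n) ^ ((d : ℤ) - l)) := by
    rw [hhi, Finset.sum_mul]
    refine SymbolBound.sum fun l hl => ?_
    have hl' := Finset.mem_Icc.1 hl
    exact (hterm A l k hl'.2 hk).mono hk le_rfl (by omega) le_rfl (by positivity)
  have hE : SymbolBound (d + 1) k (-1) (hi * B + S * R) (fun n => demodulated f ξ d n -
        ∑ l ∈ Finset.range (d + 1), (A l : ℂ) * (Complex.I * n) ^ (d - l)) := by
    refine (hhigh.add hsmooth).congr fun n _ _ => ?_
    have hsplit : Finset.range (d₁ + 1) = Finset.range (d + 1) ∪ Finset.Icc (d + 1) d₁ := by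
      ext l; simp only [Finset.mem_range, Finset.mem_union, Finset.mem_Icc]; omega
    have hdisj : Disjoint (Finset.range (d + 1)) (Finset.Icc (d + 1) d₁) := by
      rw [Finset.disjoint_left]; intro l; simp only [Finset.mem_range, Finset.mem_Icc]; omega
    rw [Pi.add_apply, hsplit, Finset.sum_union hdisj,
      Finset.sum_congr rfl fun l hl => hpow l hl n]
    ring
  have hlow : SymbolBound (d + 1) k ((d : ℤ) - 1) (∑ l ∈ Finset.Icc 1 d, |A l| * B)
      (fun n => ∑ l ∈ Finset.Icc 1 d, (A l : ℂ) * (Complex.I * n) ^ ((d : ℤ) - l)) := by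
    refine SymbolBound.sum fun l hl => ?_
    have hl' := Finset.mem_Icc.1 hl
    exact (hterm A l k (by omega) hk).mono hk le_rfl (by omega) le_rfl (by positivity)
  have hins : Finset.range (d + 1) = insert 0 (Finset.Icc 1 d) := by
    ext l; simp only [Finset.mem_range, Finset.mem_insert, Finset.mem_Icc]; omega
  have hsum0 : lo = |A 0| + ∑ l ∈ Finset.Icc 1 d, |A l| := by
    rw [hlo, hins, Finset.sum_insert (by simp)]
  have hA0 : 0 ≤ |A 0| * B := by positivity
  rw [← Finset.sum_mul] at hlow
  have hlow0 : 0 ≤ (∑ l ∈ Finset.Icc 1 d, |A l|) * B := by positivity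
  have hlB : lo * B = |A 0| * B + (∑ l ∈ Finset.Icc 1 d, |A l|) * B := by rw [hsum0]; ring
  have h3 : SymbolBound (d + 1) k ((d : ℤ) - 1)
      (hi * B + S * R + (∑ l ∈ Finset.Icc 1 d, |A l|) * B)
      (fun n => demodulated f ξ d n - (A 0 : ℂ) * (Complex.I * n) ^ d) := by
    refine ((hE.mono hk le_rfl (by omega : (-1 : ℤ) ≤ (d : ℤ) - 1) le_rfl
      (by positivity)).add hlow).congr fun n _ _ => ?_
    rw [Pi.add_apply, ← Finset.sum_congr rfl fun l hl => hpow l hl n, hins,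
      Finset.sum_insert (by simp)]
    simp only [Nat.cast_zero, sub_zero, zpow_natCast]
    ring
  refine ⟨hE.mono hk le_rfl le_rfl (by linarith [mul_nonneg hlo0 hB]) hCH,
    h3.mono hk le_rfl le_rfl (by linarith) hCH, ?_⟩
  have h0 := hterm A 0 k (Nat.zero_le _) hk
  simp only [Nat.cast_zero, sub_zero] at h0
  refine (((h3.mono hk le_rfl (by omega : (d : ℤ) - 1 ≤ d) le_rfl (by positivity)).add
    h0).mono hk le_rfl le_rfl (by linarith) hCH).congr fun n _ _ => ?_
  rw [Pi.add_apply, zpow_natCast]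
  ring

/-! ### Recovery of the jump magnitudes -/

lemma norm_pow_sub_one_le (z : ℂ) (n : ℕ) :
    ‖z ^ n - 1‖ ≤ n * ‖z - 1‖ * (1 + ‖z - 1‖) ^ n := by
  have hz : ‖z‖ ≤ 1 + ‖z - 1‖ := by
    simpa using norm_add_le 1 (z - 1)
  induction n with
  | zero => simp
  | succ n ih =>
    have h1 : (1 + ‖z - 1‖) ^ n ≤ (1 + ‖z - 1‖) ^ (n + 1) :=
      pow_le_pow_right₀ (by linarith [norm_nonneg (z - 1)]) (Nat.le_succ n)
    calc ‖z ^ (n + 1) - 1‖ = ‖z ^ n * (z - 1) + (z ^ n - 1)‖ := by congr 1; ring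
      _ ≤ ‖z ^ n * (z - 1)‖ + ‖z ^ n - 1‖ := norm_add_le _ _
      _ ≤ (1 + ‖z - 1‖) ^ n * ‖z - 1‖ + n * ‖z - 1‖ * (1 + ‖z - 1‖) ^ n := by
        rw [norm_mul, norm_pow]; gcongr
      _ = ((n : ℝ) + 1) * ‖z - 1‖ * (1 + ‖z - 1‖) ^ n := by ring
      _ ≤ _ := by push_cast; gcongr

lemma fwdDiff_iter_pow_base (z : ℂ) (s n : ℕ) :
    ((fwdDiff 1)^[s] (fun n : ℕ => z ^ n)) n = z ^ n * (z - 1) ^ s := by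
  induction s generalizing n with
  | zero => simp
  | succ s ih => rw [Function.iterate_succ_apply', fwdDiff, ih, ih]; ring

/-- A residual rotation `z`, close to `1` to order `k^{-d-2}`, produces a multiplicative error
`z ^ n - 1` that is a symbol of order `-d-1`. -/
lemma symbolBound_pow_sub_one {d k : ℕ} (hk : 1 ≤ k) {z : ℂ} {E : ℝ}
    (hz : ‖z - 1‖ ≤ E * (k : ℝ) ^ (-(d : ℤ) - 2)) (hEk : (d + 1) * E ≤ k) :
    SymbolBound d k (-(d : ℤ) - 1) (Real.exp 1 * (d + 1) * E) (fun n => z ^ n - 1) := by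
  have hk1 : (1 : ℝ) ≤ k := by exact_mod_cast hk
  have hk0 : (0 : ℝ) < k := by linarith
  have hE : 0 ≤ E := nonneg_of_mul_nonneg_left ((norm_nonneg _).trans hz) (by positivity)
  set η := ‖z - 1‖ with hη
  have hη0 : 0 ≤ η := norm_nonneg _
  have hz1 : ‖z‖ ≤ 1 + η := by simpa using norm_add_le 1 (z - 1)
  have hnk : ∀ n : ℕ, n ≤ k + d → (n : ℝ) ≤ (d + 1) * k := by
    intro n hn
    have : (n : ℝ) ≤ k + d := by exact_mod_cast hn
    nlinarith [(Nat.cast_nonneg d : (0 : ℝ) ≤ d)]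
  have hexp : ∀ n : ℕ, n ≤ k + d → (1 + η) ^ n ≤ Real.exp 1 := by
    intro n hn
    have h1 : (1 + η) ^ n ≤ Real.exp η ^ n := by
      gcongr
      linarith [Real.add_one_le_exp η]
    rw [← Real.exp_nat_mul] at h1
    refine h1.trans (Real.exp_le_exp.2 ?_)
    calc (n : ℝ) * η ≤ ((d + 1) * k) * (E * (k : ℝ) ^ (-(d : ℤ) - 2)) := by
          gcongr; exact hnk n hn
      _ = ((d + 1) * E) * ((k : ℝ) ^ (1 : ℤ) * (k : ℝ) ^ (-(d : ℤ) - 2)) := by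
          rw [zpow_one]; ring
      _ ≤ (k : ℝ) ^ (1 : ℤ) * ((k : ℝ) ^ (1 : ℤ) * (k : ℝ) ^ (-(d : ℤ) - 2)) := by
          rw [zpow_one]; gcongr
      _ = (k : ℝ) ^ (-(d : ℤ)) := by
          rw [← zpow_add₀ hk0.ne', ← zpow_add₀ hk0.ne']; congr 1; ring
      _ ≤ 1 := zpow_le_one_of_nonpos₀ hk1 (by omega)
  intro s n h1 h2
  cases s with
  | zero =>
    simp only [Function.iterate_zero, id_eq, Nat.cast_zero, sub_zero]
    calc ‖z ^ n - 1‖ ≤ n * η * (1 + η) ^ n := norm_pow_sub_one_le z n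
      _ ≤ ((d + 1) * k) * (E * (k : ℝ) ^ (-(d : ℤ) - 2)) * Real.exp 1 := by
        gcongr
        · exact hnk n h2
        · exact hexp n h2
      _ = Real.exp 1 * (d + 1) * E * ((k : ℝ) ^ (1 : ℤ) * (k : ℝ) ^ (-(d : ℤ) - 2)) := by
        rw [zpow_one]; ring
      _ = _ := by rw [← zpow_add₀ hk0.ne']; congr 2; ring
  | succ s =>
    have hsplit : (fun n : ℕ => z ^ n - 1) = (fun n : ℕ => z ^ n) + (-1 : ℂ) • fun _ => 1 := by
      ext n; simp [sub_eq_add_neg]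
    have hconst : ((fwdDiff 1)^[s + 1] (fun _ : ℕ => (1 : ℂ))) n = 0 := by
      have := fwdDiff_iter_pow_base 1 (s + 1) n
      simpa using this
    rw [hsplit, fwdDiff_iter_add, fwdDiff_iter_const_smul, Pi.add_apply, Pi.smul_apply, hconst,
      smul_zero, add_zero, fwdDiff_iter_pow_base, norm_mul, norm_pow, norm_pow]
    have hηk : η ≤ (k : ℝ) ^ (-1 : ℤ) := by
      have hEk' : E ≤ k := by
        nlinarith [mul_nonneg (Nat.cast_nonneg d : (0 : ℝ) ≤ d) hE]
      calc η ≤ E * (k : ℝ) ^ (-(d : ℤ) - 2) := hz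
        _ ≤ (k : ℝ) ^ (1 : ℤ) * (k : ℝ) ^ (-(d : ℤ) - 2) := by rw [zpow_one]; gcongr
        _ = (k : ℝ) ^ (-(d : ℤ) - 1) := by rw [← zpow_add₀ hk0.ne']; congr 1; ring
        _ ≤ _ := zpow_le_zpow_right₀ hk1 (by omega)
    calc ‖z‖ ^ n * η ^ (s + 1) = ‖z‖ ^ n * (η * η ^ s) := by rw [pow_succ]; ring
      _ ≤ Real.exp 1 * (E * (k : ℝ) ^ (-(d : ℤ) - 2) * ((k : ℝ) ^ (-1 : ℤ)) ^ s) := by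
        gcongr
        exact (pow_le_pow_left₀ (norm_nonneg _) hz1 n).trans (hexp n (by omega))
      _ = Real.exp 1 * 1 * E * (k : ℝ) ^ (-(d : ℤ) - 1 - ((s + 1 : ℕ) : ℤ)) := by
        rw [← zpow_natCast, ← zpow_mul, mul_one, mul_assoc E, ← zpow_add₀ hk0.ne', ← mul_assoc]
        congr 2
        push_cast
        ring
      _ ≤ _ := by
        gcongr
        linarith [(Nat.cast_nonneg d : (0 : ℝ) ≤ d)]

lemma sum_fin_eq_sum_pow (d n : ℕ) (b : ℕ → ℂ) :
    ∑ l : Fin (d + 1), (Complex.I * (n : ℂ)) ^ (d - (l : ℕ)) * b l =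
      ∑ j ∈ Finset.range (d + 1), (Complex.I ^ j * b (d - j)) * (n : ℂ) ^ j := by
  rw [Fin.sum_univ_eq_sum_range (fun l => (Complex.I * (n : ℂ)) ^ (d - l) * b l) (d + 1),
    ← Finset.sum_flip]
  refine Finset.sum_congr rfl fun j hj => ?_
  have := Finset.mem_range.1 hj
  rw [show d - (d - j) = j by omega, mul_pow]
  ring

/-- If `∑_l (in)^{d-l} b_l` agrees on `[k, k + d]` with a symbol of order `-1`, then
`b_l = O(k^{l-d-1})`. -/
lemma exists_norm_magnitude_le (d : ℕ) : ∃ C : ℝ, 0 ≤ C ∧ ∀ (k : ℕ) (M : ℝ)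
    (b : Fin (d + 1) → ℂ) (g : ℕ → ℂ), 1 ≤ k → 0 ≤ M → SymbolBound d k (-1) M g →
    (∀ j : Fin (d + 1), ∑ l : Fin (d + 1), (Complex.I * ((k + j : ℕ) : ℂ)) ^ (d - (l : ℕ)) * b l =
      g (k + j)) → ∀ l : Fin (d + 1), ‖b l‖ ≤ C * M * (k : ℝ) ^ (((l : ℕ) : ℤ) - d - 1) := by
  obtain ⟨C, hC, h⟩ := exists_norm_coeff_le d
  refine ⟨C, hC, fun k M b g hk hM hg hb l => ?_⟩
  set b' : ℕ → ℂ := fun l => if hl : l < d + 1 then b ⟨l, hl⟩ else 0 with hb'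
  have hbb : ∀ l : Fin (d + 1), b l = b' l := fun l => by
    simp only [hb', l.2, dif_pos, Fin.eta]
  have h1 := h k M (fun j => Complex.I ^ j * b' (d - j)) hk hM (hg.congr fun n hn1 hn2 => ?_)
    (d - l) (by omega)
  · have hl : d - (d - (l : ℕ)) = l := by omega
    rw [hl, ← hbb, norm_mul, norm_pow, Complex.norm_I, one_pow, one_mul] at h1
    rwa [show ((l : ℕ) : ℤ) - d - 1 = -1 - ((d - l : ℕ) : ℤ) by omega]
  · obtain ⟨j, rfl⟩ := Nat.exists_eq_add_of_le hn1
    have := hb ⟨j, by omega⟩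
    simp only [hbb] at this
    rw [sum_fin_eq_sum_pow] at this
    exact this.symm

lemma existsUnique_magnitudes (f : ℝ → ℝ) (d : ℕ) {k : ℕ} (hk : 1 ≤ k) (w : ℂ) :
    ∃! a : Fin (d + 1) → ℂ, SolvesMagnitudeSystem f d k w a := by
  obtain ⟨C, -, h⟩ := exists_norm_magnitude_le d
  let L : (Fin (d + 1) → ℂ) →ₗ[ℂ] (Fin (d + 1) → ℂ) := Matrix.toLin'
    (Matrix.of fun j l : Fin (d + 1) => (Complex.I * ((k + j : ℕ) : ℂ)) ^ (d - (l : ℕ)))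
  have hL : ∀ a j, L a j =
      ∑ l : Fin (d + 1), (Complex.I * ((k + j : ℕ) : ℂ)) ^ (d - (l : ℕ)) * a l := fun a j => by
    simp only [L, Matrix.toLin'_apply, Matrix.mulVec, dotProduct, Matrix.of_apply]
  have hinj : Function.Injective L := by
    refine (injective_iff_map_eq_zero L).2 fun b hb => funext fun l => ?_
    -- the coefficient bound with zero data gives a trivial kernel
    have h0 : SymbolBound d k (-1) 0 (fun _ => 0) := by
      simpa using symbolBound_of_norm_le (N := d) hk (a := -1) le_rfl (g := fun _ => (0 : ℂ))
        (by simp)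
    have := h k 0 b (fun _ => 0) hk le_rfl h0 (fun j => by rw [← hL, hb]; rfl) l
    simpa using this
  have hsurj : Function.Surjective L := LinearMap.injective_iff_surjective.1 hinj
  obtain ⟨a, ha⟩ := hsurj fun j => rSeq f d (k + j) * w ^ (-((k + j : ℕ) : ℤ))
  refine ⟨a, fun j => by rw [← hL, ha], fun b hb => hinj ?_⟩
  rw [ha]
  exact funext fun j => by rw [hL, hb j]

/-- Recovery of the magnitudes from any approximate jump location of order `k^{-d-2}`. -/
lemma exists_magnitude_bound {d d₁ : ℕ} (hd : 2 * d + 1 ≤ d₁) (C₁ : ℝ) :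
    ∃ C K : ℝ, 0 < C ∧ 0 < K ∧
      ∀ (f : ℝ → ℝ) (ξ : ℝ) (A : ℕ → ℝ) (R : ℝ), IsSingleJump f ξ d₁ A →
        SmoothPartBound f ξ d₁ A R → ∀ k : ℕ, K * sizeH d d₁ A R < (k : ℝ) → ∀ w : ℂ,
          ‖w - jumpPoint ξ‖ ≤ C₁ * sizeH d d₁ A R * (k : ℝ) ^ (-(d : ℤ) - 2) →
          (∃! a : Fin (d + 1) → ℂ, SolvesMagnitudeSystem f d k w a) ∧
          ∀ a : Fin (d + 1) → ℂ, SolvesMagnitudeSystem f d k w a →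
            ∀ l : Fin (d + 1), ‖a l - (A l : ℂ)‖ ≤
              C * sizeH d d₁ A R ^ 2 * (k : ℝ) ^ (((l : ℕ) : ℤ) - (d : ℤ) - 1) := by
  obtain ⟨B, hB, hsym⟩ := exists_symbolBound_demodulated hd
  obtain ⟨G, hG, hmag⟩ := exists_norm_magnitude_le d
  set c : ℝ := |C₁| with hc
  have hc0 : 0 ≤ c := abs_nonneg _
  set Q : ℝ := 2 ^ d * (Real.exp 1 * (d + 1) * (2 * c) * B) + B with hQ
  have hQ0 : 0 < Q := by positivity
  refine ⟨G * Q + 1, 2 * c * (d + 1) + 1, by positivity, by positivity,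
    fun f ξ A R hf hR k hkK w hw => ?_⟩
  have hH2 : 2 ≤ sizeH d d₁ A R := two_le_sizeH hR.nonneg
  set H := sizeH d d₁ A R with hH
  have hcdH : 0 ≤ c * (d + 1) * H := by positivity
  have hkR : (2 : ℝ) < k := by nlinarith
  have hk : 1 ≤ k := by exact_mod_cast (by linarith : (1 : ℝ) ≤ k)
  have hk1 : (1 : ℝ) ≤ k := by linarith
  have hk0 : (0 : ℝ) < k := by linarith
  refine ⟨existsUnique_magnitudes f d hk w, fun a ha => ?_⟩
  obtain ⟨hE, -, hm⟩ := hsym f ξ A R hf hR k hk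
  rw [← hH] at hE hm
  have hω := norm_jumpPoint ξ
  have hEk : (d + 1) * (2 * c * H) ≤ k := by nlinarith
  have hcd : 0 ≤ c * d * H := by positivity
  have hcH : 2 * (c * H) ≤ k := by linarith
  have hw' : ‖w - jumpPoint ξ‖ ≤ c * H * (k : ℝ) ^ (-(d : ℤ) - 2) := by
    refine hw.trans ?_
    gcongr
    exact le_abs_self C₁
  have hhalf : ‖w - jumpPoint ξ‖ ≤ 1 / 2 := by
    calc ‖w - jumpPoint ξ‖ ≤ c * H * (k : ℝ) ^ (-(d : ℤ) - 2) := hw'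
      _ ≤ (k / 2) * (k : ℝ) ^ (-1 : ℤ) := by
        gcongr
        · linarith
        · omega
      _ = 1 / 2 := by rw [zpow_neg_one]; field_simp
  have hwnorm : 1 / 2 ≤ ‖w‖ := by
    have := norm_sub_norm_le (jumpPoint ξ) w
    rw [norm_sub_rev] at this
    linarith
  have hw0 : w ≠ 0 := norm_pos_iff.1 (by linarith)
  set z : ℂ := jumpPoint ξ / w with hz
  have hz1 : ‖z - 1‖ ≤ 2 * c * H * (k : ℝ) ^ (-(d : ℤ) - 2) := by
    have : z - 1 = -(w - jumpPoint ξ) / w := by rw [hz]; field_simp; ring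
    rw [this, norm_div, norm_neg, div_le_iff₀ (by linarith)]
    have hnn : 0 ≤ c * H * (k : ℝ) ^ (-(d : ℤ) - 2) := by positivity
    nlinarith
  -- `r_n w^{-n} = z^n m_n`, so the error of the data is `(z^n - 1) m_n` plus the tail of `m_n`
  have hrot := (symbolBound_pow_sub_one hk hz1 hEk).mul hk (by positivity) (by positivity)
    (hm.mono hk (Nat.le_succ d) le_rfl le_rfl (by positivity))
  rw [show -(d : ℤ) - 1 + d = -1 by ring] at hrot
  have hBH : B * H ≤ B * H ^ 2 := by
    gcongr
    nlinarith
  have htot := (hrot.add (hE.mono hk (Nat.le_succ d) le_rfl le_rfl (by positivity))).mono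
    (M' := Q * H ^ 2) hk le_rfl le_rfl (by rw [hQ]; linarith) (by positivity)
  intro l
  refine (hmag k (Q * H ^ 2) (fun l => a l - A l) _ hk (by positivity) htot
    (fun j => ?_) l).trans ?_
  · have hj := ha j
    simp only [mul_sub, Finset.sum_sub_distrib]
    rw [← hj, rSeq_eq_mul_demodulated f ξ, zpow_neg, zpow_natCast, Pi.add_apply, Pi.mul_apply, hz,
      div_pow, ← Fin.sum_univ_eq_sum_range
        (fun l => (A l : ℂ) * (Complex.I * ((k + j : ℕ) : ℂ)) ^ (d - l)) (d + 1)]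
    simp only [mul_comm (A _ : ℂ)]
    ring
  · rw [← mul_assoc]
    gcongr
    linarith

/-! ### A Laguerre polynomial without imaginary roots -/

open Polynomial in
/-- If all roots of `p` lie in the closed right half-plane, then so do those of `p' - p`, and
`p' - p` vanishes on the imaginary axis only at roots of `p`. -/
lemma eval_derivative_sub_ne_zero {p : ℂ[X]} (hp : ∀ z, p.eval z = 0 → 0 ≤ z.re) {z : ℂ}
    (hz : z.re ≤ 0) (h : p.eval z ≠ 0) : (derivative p - p).eval z ≠ 0 := by
  intro h0
  have hp0 : p ≠ 0 := by rintro rfl; simp at h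
  have h1 : (derivative p).eval z / p.eval z = 1 := by
    rw [eval_sub, sub_eq_zero] at h0
    rw [h0, div_self h]
  rw [(IsAlgClosed.splits p).eval_derivative_div_eval_of_ne_zero h] at h1
  have h2 : ((p.roots.map fun w ↦ 1 / (z - w)).sum).re ≤ 0 := by
    have e : ((p.roots.map fun w ↦ 1 / (z - w)).sum).re =
        (p.roots.map fun w ↦ (1 / (z - w)).re).sum := by
      have := map_multiset_sum Complex.reAddGroupHom (p.roots.map fun w ↦ 1 / (z - w))
      simpa [Multiset.map_map, Function.comp_def] using this
    rw [e]
    refine Multiset.sum_induction (· ≤ 0) _ (fun _ _ => add_nonpos) le_rfl fun x hx => ?_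
    obtain ⟨w, hw, rfl⟩ := Multiset.mem_map.1 hx
    have hw0 := hp w ((mem_roots hp0).1 hw)
    rw [one_div, Complex.inv_re, Complex.sub_re]
    exact div_nonpos_of_nonpos_of_nonneg (by linarith) (Complex.normSq_nonneg _)
  rw [h1] at h2
  norm_num at h2

open Polynomial in
/-- `(D - 1)^j X^d`; for `j = d + 1` this is, up to normalisation, the associated Laguerre
polynomial `L_d^{(1)}`. -/
noncomputable def laguerreIter (d j : ℕ) : ℂ[X] :=
  ((derivative - 1 : Module.End ℂ ℂ[X]) ^ j) (X ^ d)

open Polynomial in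
lemma laguerreIter_zero (d : ℕ) : laguerreIter d 0 = X ^ d := rfl

open Polynomial in
lemma laguerreIter_succ (d j : ℕ) :
    laguerreIter d (j + 1) = derivative (laguerreIter d j) - laguerreIter d j := by
  rw [laguerreIter, pow_succ', Module.End.mul_apply]
  rfl

open Polynomial in
lemma laguerreIter_re_nonneg (d j : ℕ) : ∀ z, (laguerreIter d j).eval z = 0 → 0 ≤ z.re := by
  induction j with
  | zero =>
    intro z hz
    rw [laguerreIter_zero, eval_pow, eval_X] at hz
    rw [eq_zero_of_pow_eq_zero hz, Complex.zero_re]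
  | succ j ih =>
    intro z hz
    by_contra! hneg
    rw [laguerreIter_succ] at hz
    by_cases h : (laguerreIter d j).eval z = 0
    · exact absurd (ih z h) (not_le.2 hneg)
    · exact eval_derivative_sub_ne_zero ih hneg.le h hz

open Polynomial in
lemma derivative_iterate_X_pow_eq_sum_laguerreIter (d j : ℕ) :
    derivative^[j] (X ^ d : ℂ[X]) =
      ∑ t ∈ Finset.range (j + 1), (j.choose t : ℂ[X]) * laguerreIter d t := by
  have h := (Commute.one_right (derivative - 1 : Module.End ℂ ℂ[X])).add_pow j
  rw [sub_add_cancel] at h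
  rw [← Module.End.pow_apply, h, LinearMap.sum_apply]
  refine Finset.sum_congr rfl fun t _ => ?_
  rw [one_pow, mul_one, ← Nat.cast_comm, Module.End.mul_apply, Module.End.natCast_apply,
    nsmul_eq_mul, laguerreIter]

open Polynomial in
/-- An imaginary root of `(D - 1)^{d+1} X^d` would be a root of all `(D - 1)^j X^d` with
`j ≤ d + 1`, hence of `D^d X^d = d!`. -/
lemma eval_laguerreIter_ne_zero {d : ℕ} {z : ℂ} (hz : z.re = 0) :
    (laguerreIter d (d + 1)).eval z ≠ 0 := by
  intro h
  have hall : ∀ t ≤ d + 1, (laguerreIter d (d + 1 - t)).eval z = 0 := by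
    intro t
    induction t with
    | zero => intro _; simpa using h
    | succ t ih =>
      intro ht
      by_contra hne
      have := ih (by omega)
      rw [show d + 1 - t = (d + 1 - (t + 1)) + 1 by omega, laguerreIter_succ] at this
      exact eval_derivative_sub_ne_zero (laguerreIter_re_nonneg d _) hz.le hne this
  have hd := congrArg (eval z) (derivative_iterate_X_pow_eq_sum_laguerreIter d d)
  rw [iterate_derivative_X_pow_eq_natCast_mul, eval_finsetSum,
    Finset.sum_eq_zero] at hd
  · simp [Nat.descFactorial_self, Nat.factorial_ne_zero] at hd
  · intro t ht
    have ht' := Finset.mem_range.1 ht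
    have := hall (d + 1 - t) (by omega)
    rw [show d + 1 - (d + 1 - t) = t by omega] at this
    rw [eval_mul, this, mul_zero]

open Polynomial in
lemma laguerreIter_eq_sum (d j : ℕ) :
    laguerreIter d j = ∑ t ∈ Finset.range (j + 1),
      ((-1) ^ (j - t) * (j.choose t : ℂ[X])) * ((d.descFactorial t : ℂ[X]) * X ^ (d - t)) := by
  have h := (Commute.neg_one_right (derivative : Module.End ℂ ℂ[X])).add_pow j
  rw [laguerreIter, sub_eq_add_neg, h, LinearMap.sum_apply]
  refine Finset.sum_congr rfl fun t _ => ?_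
  have e : ((-1) ^ (j - t) * (j.choose t : Module.End ℂ ℂ[X])) =
      (((-1) ^ (j - t) * (j.choose t : ℤ) : ℤ) : Module.End ℂ ℂ[X]) := by push_cast; rfl
  rw [mul_assoc, e, ← Int.cast_comm, Module.End.mul_apply, Module.End.intCast_apply,
    Module.End.pow_apply, iterate_derivative_X_pow_eq_natCast_mul, zsmul_eq_mul]
  push_cast
  rfl

/-- The coefficient of `X ^ (d - t)` in `(-1)^{d+1} (D - 1)^{d+1} X^d`; the sign makes the
polynomial monic. -/
def laguerreCoeff (d t : ℕ) : ℂ := (-1) ^ t * ((d + 1).choose t : ℂ) * (d.descFactorial t : ℂ)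

lemma laguerreCoeff_zero (d : ℕ) : laguerreCoeff d 0 = 1 := by simp [laguerreCoeff]

lemma sum_laguerreCoeff_ne_zero {d : ℕ} {z : ℂ} (hz : z.re = 0) :
    ∑ t ∈ Finset.range (d + 1), laguerreCoeff d t * z ^ (d - t) ≠ 0 := by
  intro h
  refine eval_laguerreIter_ne_zero (d := d) hz ?_
  rw [laguerreIter_eq_sum, Polynomial.eval_finsetSum, Finset.sum_range_succ]
  have e : ∀ t ∈ Finset.range (d + 1), Polynomial.eval z (((-1) ^ (d + 1 - t) *
      ((d + 1).choose t : Polynomial ℂ)) * ((d.descFactorial t : Polynomial ℂ) *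
        Polynomial.X ^ (d - t))) = (-1) ^ (d + 1) * (laguerreCoeff d t * z ^ (d - t)) := by
    intro t ht
    have ht' := Finset.mem_range.1 ht
    have hs : (-1 : ℂ) ^ (d + 1 - t) = (-1) ^ (d + 1) * (-1) ^ t := by
      rw [← pow_add, show d + 1 + t = (d + 1 - t) + 2 * t by omega, pow_add, pow_mul]
      simp
    simp only [Polynomial.eval_mul, Polynomial.eval_pow, Polynomial.eval_neg, Polynomial.eval_one,
      Polynomial.eval_natCast, Polynomial.eval_X, laguerreCoeff, hs]
    ring
  rw [Finset.sum_congr rfl e, ← Finset.mul_sum, h]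
  simp

/-! ### Perturbation of the limiting root problem -/

open Polynomial in
/-- The smallest root of `p` is at most the geometric mean of all of them. -/
lemma exists_root_norm_pow_le {p : ℂ[X]} (hp : p.natDegree ≠ 0) :
    ∃ z, p.eval z = 0 ∧ ‖z‖ ^ p.natDegree * ‖p.leadingCoeff‖ ≤ ‖p.coeff 0‖ := by
  have hs := IsAlgClosed.splits p
  have hp0 : p ≠ 0 := by rintro rfl; simp at hp
  have hlead : 0 < ‖p.leadingCoeff‖ := norm_pos_iff.2 (leadingCoeff_ne_zero.2 hp0)
  have hcard := hs.natDegree_eq_card_roots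
  have hprod : ‖p.coeff 0‖ = ‖p.leadingCoeff‖ * (p.roots.map (‖·‖)).prod := by
    rw [hs.coeff_zero_eq_leadingCoeff_mul_prod_roots, norm_mul, norm_mul, norm_pow, norm_neg,
      norm_one, one_pow, one_mul]
    congr 1
    exact map_multiset_prod (normHom : ℂ →*₀ ℝ) p.roots
  have hne : p.roots.toFinset.Nonempty := by
    rw [Multiset.toFinset_nonempty]
    rintro h
    rw [h] at hcard
    exact hp (by simpa using hcard)
  obtain ⟨z, hz, hmin⟩ := p.roots.toFinset.exists_min_image (‖·‖) hne
  have hz' := Multiset.mem_toFinset.1 hz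
  refine ⟨z, ((mem_roots hp0).1 hz'), ?_⟩
  rw [hprod, mul_comm, hcard]
  refine mul_le_mul_of_nonneg_left ?_ hlead.le
  have := Multiset.prod_map_le_prod_map₀ (s := p.roots) (fun _ => ‖z‖) (‖·‖)
    (fun _ _ => norm_nonneg _) (fun w hw => hmin w (Multiset.mem_toFinset.2 hw))
  simpa using this

/-- The roots of `q` in the scaled variable `y = k (z / ω - 1)` solve `y F(y) + g = 0`, where the
coefficients of `F` are close to those of a polynomial without imaginary roots and `g` is small.
Such an equation has a root of size `O(|g|)`, and every root is either that small or away from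
the imaginary axis. -/
lemma exists_perturbed_root_bounds (d : ℕ) : ∃ ε c Y : ℝ, 0 < ε ∧ 0 < c ∧ 0 < Y ∧
    ∀ (b : ℕ → ℂ) (g : ℂ), (∀ t ≤ d, ‖b t - laguerreCoeff d t‖ ≤ ε) → ‖g‖ ≤ ε →
      (∃ y : ℂ, y * ∑ t ∈ Finset.range (d + 1), b t * y ^ (d - t) + g = 0 ∧ c * ‖y‖ ≤ ‖g‖) ∧
      ∀ y : ℂ, y * ∑ t ∈ Finset.range (d + 1), b t * y ^ (d - t) + g = 0 →
        ‖y‖ ≤ Y ∧ (|y.re| ≤ ε → c * ‖y‖ ≤ ‖g‖) := by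
  set Q : ℂ → ℂ := fun y => ∑ t ∈ Finset.range (d + 1), laguerreCoeff d t * y ^ (d - t) with hQ
  have hQc : Continuous Q := by fun_prop
  -- `B` dominates the sum of the moduli of the coefficients and the leading one is at least `1/2`
  -- in modulus, so every root is bounded by `2 * B`
  set B : ℝ := ∑ t ∈ Finset.range (d + 1), (‖laguerreCoeff d t‖ + 1) + 1 with hB
  have hB1 : 1 ≤ B := by
    have : 0 ≤ ∑ t ∈ Finset.range (d + 1), (‖laguerreCoeff d t‖ + 1) :=
      Finset.sum_nonneg fun _ _ => by positivity
    linarith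
  set Y : ℝ := 2 * B with hY
  have hY0 : 0 < Y := by linarith
  have hY1 : 1 ≤ Y := by linarith
  obtain ⟨m, hm, hmQ⟩ : ∃ m : ℝ, 0 < m ∧ ∀ y : ℂ, ‖y‖ ≤ Y → y.re = 0 → m ≤ ‖Q y‖ := by
    have hcomp : IsCompact (Metric.closedBall (0 : ℂ) Y ∩ {y | y.re = 0}) :=
      (isCompact_closedBall 0 Y).inter_right
        (isClosed_eq Complex.continuous_re continuous_const)
    have hne : (Metric.closedBall (0 : ℂ) Y ∩ {y | y.re = 0}).Nonempty :=
      ⟨0, by simp [hY0.le], by simp⟩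
    obtain ⟨y₀, hy₀, hmin⟩ := hcomp.exists_isMinOn hne hQc.norm.continuousOn
    refine ⟨‖Q y₀‖, norm_pos_iff.2 (sum_laguerreCoeff_ne_zero hy₀.2), fun y hy hy' => ?_⟩
    exact hmin ⟨by simpa using hy, hy'⟩
  obtain ⟨δ, hδ, hδQ⟩ := Metric.uniformContinuousOn_iff.1
    ((isCompact_closedBall (0 : ℂ) Y).uniformContinuousOn_of_continuous hQc.continuousOn)
    (m / 2) (by positivity)
  set S : ℝ := (d + 1) * Y ^ d with hS
  have hS0 : 0 < S := by positivity
  set ε₁ : ℝ := min (min (1 / 2) (δ / 2)) (m / (4 * S)) with hε₁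
  have hε₁0 : 0 < ε₁ := by positivity
  have hε₁a : ε₁ ≤ 1 / 2 := (min_le_left _ _).trans (min_le_left _ _)
  have hε₁b : ε₁ ≤ δ / 2 := (min_le_left _ _).trans (min_le_right _ _)
  have hε₁c : ε₁ * S ≤ m / 4 := by
    calc ε₁ * S ≤ m / (4 * S) * S := by gcongr; exact min_le_right _ _
      _ = m / 4 := by field_simp
  -- the product of the `d + 1` roots is `g / b 0`, so this makes the smallest root at most `ε₁`
  set ε : ℝ := ε₁ ^ (d + 1) / 2 with hε
  have hε0 : 0 < ε := by positivity
  have hεε₁ : ε ≤ ε₁ := by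
    have : ε₁ ^ (d + 1) ≤ ε₁ ^ 1 := pow_le_pow_of_le_one hε₁0.le (by linarith) (by omega)
    rw [pow_one] at this
    rw [hε]; linarith
  refine ⟨ε, m / 4, Y, hε0, by positivity, hY0, fun b g hb hg => ?_⟩
  have hb0 : 1 / 2 ≤ ‖b 0‖ := by
    have h1 := hb 0 (Nat.zero_le _)
    rw [laguerreCoeff_zero, norm_sub_rev] at h1
    have h2 := norm_sub_norm_le (1 : ℂ) (b 0)
    rw [norm_one] at h2
    linarith
  have hbt : ∀ t ≤ d, ‖b t‖ ≤ ‖laguerreCoeff d t‖ + 1 := fun t ht => by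
    have h1 := hb t ht
    have h2 := norm_sub_norm_le (b t) (laguerreCoeff d t)
    linarith
  have hroot_le : ∀ y : ℂ, y * ∑ t ∈ Finset.range (d + 1), b t * y ^ (d - t) + g = 0 →
      ‖y‖ ≤ Y := by
    intro y hy
    by_contra! hlt
    have hy1 : 1 ≤ ‖y‖ := by linarith
    rw [Finset.sum_range_succ', mul_add, Nat.sub_zero, mul_left_comm, ← pow_succ'] at hy
    have h1 : b 0 * y ^ (d + 1) =
        -(y * ∑ t ∈ Finset.range d, b (t + 1) * y ^ (d - (t + 1)) + g) := by linear_combination hy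
    have h2 : ‖∑ t ∈ Finset.range d, y * (b (t + 1) * y ^ (d - (t + 1)))‖ ≤
        ∑ t ∈ Finset.range d, (‖laguerreCoeff d (t + 1)‖ + 1) * ‖y‖ ^ d := by
      refine norm_sum_le_of_le _ fun t ht => ?_
      have ht' := Finset.mem_range.1 ht
      rw [mul_left_comm, ← pow_succ', norm_mul, norm_pow]
      gcongr
      · exact hbt (t + 1) (by omega)
      · omega
    have h3 : ‖b 0 * y ^ (d + 1)‖ ≤ B * ‖y‖ ^ d := by
      rw [h1, norm_neg, Finset.mul_sum]
      refine (norm_add_le _ _).trans ?_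
      have hg1 : ‖g‖ ≤ 1 * ‖y‖ ^ d := by
        rw [one_mul]
        exact (by linarith : ‖g‖ ≤ 1).trans (one_le_pow₀ hy1)
      refine (add_le_add h2 hg1).trans ?_
      rw [← Finset.sum_mul, ← add_mul]
      gcongr
      rw [hB, Finset.sum_range_succ']
      linarith [norm_nonneg (laguerreCoeff d 0)]
    rw [norm_mul, norm_pow, pow_succ', ← mul_assoc] at h3
    have h4 := le_of_mul_le_mul_right h3 (by positivity)
    nlinarith
  have hsmall : ∀ y : ℂ, y * ∑ t ∈ Finset.range (d + 1), b t * y ^ (d - t) + g = 0 →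
      |y.re| ≤ ε₁ → m / 4 * ‖y‖ ≤ ‖g‖ := by
    intro y hy hre
    have hyY := hroot_le y hy
    set y' : ℂ := ⟨0, y.im⟩ with hy'
    have hy'Y : ‖y'‖ ≤ Y := by
      have h1 : ‖y'‖ = |y.im| := by
        have : y' = (y.im : ℂ) * Complex.I := by
          apply Complex.ext <;> simp [hy']
        rw [this]; simp
      rw [h1]
      exact (Complex.abs_im_le_norm y).trans hyY
    have hdist : dist y y' < δ := by
      have : y - y' = (y.re : ℂ) := by apply Complex.ext <;> simp [hy']
      rw [dist_eq_norm, this, Complex.norm_real, Real.norm_eq_abs]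
      linarith
    have h1 := hδQ y (by simpa using hyY) y' (by simpa using hy'Y) hdist
    have h2 := hmQ y' hy'Y rfl
    have h3 : m / 2 ≤ ‖Q y‖ := by
      rw [dist_eq_norm, norm_sub_rev] at h1
      have := norm_sub_norm_le (Q y') (Q y)
      linarith
    have h4 : ‖Q y - ∑ t ∈ Finset.range (d + 1), b t * y ^ (d - t)‖ ≤ m / 4 := by
      rw [hQ, ← Finset.sum_sub_distrib]
      calc _ ≤ ∑ _t ∈ Finset.range (d + 1), ε₁ * Y ^ d := by
            refine norm_sum_le_of_le _ fun t ht => ?_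
            have ht' := Finset.mem_range.1 ht
            rw [← sub_mul, norm_mul, norm_pow, norm_sub_rev]
            gcongr
            · exact (hb t (by omega)).trans hεε₁
            · calc ‖y‖ ^ (d - t) ≤ Y ^ (d - t) := by gcongr
                _ ≤ Y ^ d := pow_le_pow_right₀ hY1 (Nat.sub_le _ _)
        _ = ε₁ * S := by rw [hS]; simp; ring
        _ ≤ _ := hε₁c
    have h5 : m / 4 ≤ ‖∑ t ∈ Finset.range (d + 1), b t * y ^ (d - t)‖ := by
      have := norm_sub_norm_le (Q y) (∑ t ∈ Finset.range (d + 1), b t * y ^ (d - t))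
      linarith
    have h6 : ‖g‖ = ‖y‖ * ‖∑ t ∈ Finset.range (d + 1), b t * y ^ (d - t)‖ := by
      rw [← norm_mul, ← norm_neg g]
      congr 1
      linear_combination -hy
    rw [h6, mul_comm]
    gcongr
  refine ⟨?_, fun y hy => ⟨hroot_le y hy, fun hre => hsmall y hy (hre.trans hεε₁)⟩⟩
  open Polynomial in
  set p : ℂ[X] := X * ∑ t ∈ Finset.range (d + 1), C (b t) * X ^ (d - t) + C g with hp
  have hpeval : ∀ y, p.eval y =
      y * ∑ t ∈ Finset.range (d + 1), b t * y ^ (d - t) + g := fun y => by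
    simp [hp, Polynomial.eval_finsetSum]
  have hp0 : p.coeff 0 = g := by
    rw [Polynomial.coeff_zero_eq_eval_zero, hpeval]; simp
  have hsum_coeff : (∑ t ∈ Finset.range (d + 1),
      Polynomial.C (b t) * Polynomial.X ^ (d - t)).coeff d = b 0 := by
    rw [Polynomial.finsetSum_coeff, Finset.sum_eq_single 0]
    · simp
    · intro t ht ht0
      have ht' := Finset.mem_range.1 ht
      rw [Polynomial.coeff_C_mul_X_pow, if_neg (by omega)]
    · simp
  have hpd : p.coeff (d + 1) = b 0 := by
    rw [hp, Polynomial.coeff_add, Polynomial.coeff_X_mul, hsum_coeff, Polynomial.coeff_C_succ,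
      add_zero]
  have hb0' : b 0 ≠ 0 := norm_pos_iff.1 (by linarith)
  have hdeg_le : p.natDegree ≤ d + 1 := by
    refine Polynomial.natDegree_add_le_of_degree_le ?_ (by simp)
    refine Polynomial.natDegree_mul_le.trans ?_
    have : (∑ t ∈ Finset.range (d + 1),
        Polynomial.C (b t) * Polynomial.X ^ (d - t)).natDegree ≤ d :=
      Polynomial.natDegree_sum_le_of_forall_le _ _ fun t _ =>
        (Polynomial.natDegree_C_mul_X_pow_le _ _).trans (Nat.sub_le _ _)
    rw [Polynomial.natDegree_X]
    omega
  have hdeg : p.natDegree = d + 1 :=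
    Polynomial.natDegree_eq_of_le_of_coeff_ne_zero hdeg_le (by rw [hpd]; exact hb0')
  obtain ⟨y, hy, hynorm⟩ := exists_root_norm_pow_le (p := p) (by omega)
  rw [Polynomial.leadingCoeff, hdeg, hpd, hp0] at hynorm
  rw [hpeval] at hy
  refine ⟨y, hy, hsmall y hy ((Complex.abs_re_le_norm y).trans ?_)⟩
  have hpow : ‖y‖ ^ (d + 1) ≤ ε₁ ^ (d + 1) := by
    have h1 : ‖y‖ ^ (d + 1) * (1 / 2) ≤ ‖g‖ :=
      (mul_le_mul_of_nonneg_left hb0 (by positivity)).trans hynorm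
    have h2 : ε₁ ^ (d + 1) = 2 * ε := by rw [hε]; ring
    linarith
  exact le_of_pow_le_pow_left₀ (by omega) hε₁0.le hpow

/-! ### The polynomial `q` in the scaled variable -/

lemma sub_pow_apply (T : Module.End ℂ (ℕ → ℂ)) (v : ℂ) (n k : ℕ) (g : ℕ → ℂ) :
    ((v • (1 : Module.End ℂ (ℕ → ℂ)) - T) ^ n) g k =
      ∑ j ∈ Finset.range (n + 1), (-1) ^ j * (n.choose j : ℂ) * (T ^ j) g k * v ^ (n - j) := by
  have hcomm : Commute (-T) (v • (1 : Module.End ℂ (ℕ → ℂ))) :=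
    ((Commute.one_right (-T)).smul_right v)
  rw [sub_eq_neg_add, hcomm.add_pow, LinearMap.sum_apply, Finset.sum_apply]
  refine Finset.sum_congr rfl fun j _ => ?_
  have h1 : (-T) ^ j = ((-1 : ℂ) ^ j) • T ^ j := by
    rw [← neg_one_smul ℂ T, smul_pow]
  rw [h1, smul_pow, one_pow, ← Nat.cast_comm, Module.End.mul_apply, Module.End.mul_apply,
    Module.End.natCast_apply]
  simp only [LinearMap.smul_apply, Module.End.one_apply, map_smul, Pi.smul_apply, smul_eq_mul,
    nsmul_eq_mul]
  ring

/-- The binomial sums `∑_j (-1)^j C(n,j) g(k+j) u^{n-j}` are expansions of `(u - S)^n g` in the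
shift `S`; expanding `((u - 1) - Δ)^n` instead recentres them at `u = 1`. -/
lemma sum_shift_eq_sum_fwdDiff (g : ℕ → ℂ) (u : ℂ) (n k : ℕ) :
    ∑ j ∈ Finset.range (n + 1), (-1) ^ j * (n.choose j : ℂ) * g (k + j) * u ^ (n - j) =
      ∑ t ∈ Finset.range (n + 1),
        (-1) ^ t * (n.choose t : ℂ) * ((fwdDiff 1)^[t] g) k * (u - 1) ^ (n - t) := by
  let S : Module.End ℂ (ℕ → ℂ) := LinearMap.funLeft ℂ ℂ (· + 1)
  have hS : ∀ (j k : ℕ) (g : ℕ → ℂ), (S ^ j) g k = g (k + j) := by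
    intro j
    induction j with
    | zero => intro k g; simp
    | succ j ih =>
      intro k g
      rw [pow_succ, Module.End.mul_apply, ih]
      rfl
  have hD : ∀ (t : ℕ) (g : ℕ → ℂ), ((S - 1) ^ t) g = (fwdDiff 1)^[t] g := by
    intro t
    induction t with
    | zero => intro g; simp
    | succ t ih =>
      intro g
      rw [pow_succ, Module.End.mul_apply, ih, Function.iterate_succ_apply]
      rfl
  have h : u • (1 : Module.End ℂ (ℕ → ℂ)) - S = (u - 1) • (1 : Module.End ℂ (ℕ → ℂ)) - (S - 1) := by
    ext g n
    simp [sub_mul]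
  have h1 := sub_pow_apply S u n k g
  rw [h, sub_pow_apply] at h1
  simp only [hS, hD] at h1
  exact h1.symm

/-- The coefficient of `y ^ (d + 1 - t)` in `(k / α) ω^{-(k+d+1)} q(ω (1 + y / k))`. The factor `k`
makes the coefficients with `t ≤ d` of order one, since `Δ^t m_k = O(k^{d-t})`. -/
noncomputable def scaledCoeff (f : ℝ → ℝ) (ξ : ℝ) (d k : ℕ) (α : ℂ) (t : ℕ) : ℂ :=
  (-1) ^ t * ((d + 1).choose t : ℂ) * ((fwdDiff 1)^[t] (demodulated f ξ d)) k *
    (k : ℂ) ^ ((t : ℤ) - d) / α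

lemma qPoly_scaled (f : ℝ → ℝ) (ξ : ℝ) (d : ℕ) {k : ℕ} (hk : 1 ≤ k) (α y : ℂ) :
    y * ∑ t ∈ Finset.range (d + 1), scaledCoeff f ξ d k α t * y ^ (d - t) +
        scaledCoeff f ξ d k α (d + 1) =
      k / α * (jumpPoint ξ ^ (k + (d + 1)))⁻¹ * qPoly f d k (jumpPoint ξ * (1 + y / k)) := by
  have hk0 : (k : ℂ) ≠ 0 := by exact_mod_cast (by omega : k ≠ 0)
  have hω : jumpPoint ξ ^ (k + (d + 1)) ≠ 0 := pow_ne_zero _ (jumpPoint_ne_zero ξ)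
  have hq : qPoly f d k (jumpPoint ξ * (1 + y / k)) = jumpPoint ξ ^ (k + (d + 1)) *
      ∑ t ∈ Finset.range (d + 1 + 1), (-1) ^ t * ((d + 1).choose t : ℂ) *
        ((fwdDiff 1)^[t] (demodulated f ξ d)) k * (y / k) ^ (d + 1 - t) := by
    have h := sum_shift_eq_sum_fwdDiff (demodulated f ξ d) (1 + y / k) (d + 1) k
    rw [add_sub_cancel_left] at h
    rw [← h, qPoly, Finset.mul_sum]
    refine Finset.sum_congr rfl fun j hj => ?_
    have hj' := Finset.mem_range.1 hj
    rw [rSeq_eq_mul_demodulated f ξ, mul_pow,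
      show k + (d + 1) = (k + j) + (d + 1 - j) by omega, pow_add (jumpPoint ξ) (k + j)]
    ring
  have hterm : ∀ t ∈ Finset.range (d + 1 + 1), scaledCoeff f ξ d k α t * y ^ (d + 1 - t) =
      k / α * ((-1) ^ t * ((d + 1).choose t : ℂ) *
        ((fwdDiff 1)^[t] (demodulated f ξ d)) k * (y / k) ^ (d + 1 - t)) := by
    intro t ht
    have ht' := Finset.mem_range.1 ht
    have e : (k : ℂ) ^ ((t : ℤ) - d) = k * ((k : ℂ) ^ (d + 1 - t))⁻¹ := by
      rw [show (t : ℤ) - d = 1 + -((d + 1 - t : ℕ) : ℤ) by omega, zpow_add₀ hk0, zpow_one,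
        zpow_neg, zpow_natCast]
    rw [scaledCoeff, e, div_pow]
    ring
  rw [hq, mul_assoc, inv_mul_cancel_left₀ hω, Finset.mul_sum (Finset.range (d + 1 + 1)),
    ← Finset.sum_congr rfl hterm,
    Finset.sum_range_succ _ (d + 1), Nat.sub_self, pow_zero, mul_one, Finset.mul_sum]
  congr 1
  refine Finset.sum_congr rfl fun t ht => ?_
  have ht' := Finset.mem_range.1 ht
  rw [show d + 1 - t = d - t + 1 by omega, pow_succ]
  ring

lemma qPoly_eq_zero_iff (f : ℝ → ℝ) (ξ : ℝ) (d : ℕ) {k : ℕ} (hk : 1 ≤ k) {α : ℂ} (hα : α ≠ 0)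
    (y : ℂ) :
    qPoly f d k (jumpPoint ξ * (1 + y / k)) = 0 ↔
      y * ∑ t ∈ Finset.range (d + 1), scaledCoeff f ξ d k α t * y ^ (d - t) +
        scaledCoeff f ξ d k α (d + 1) = 0 := by
  have hk0 : (k : ℂ) ≠ 0 := by exact_mod_cast (by omega : k ≠ 0)
  have hω : jumpPoint ξ ^ (k + (d + 1)) ≠ 0 := pow_ne_zero _ (jumpPoint_ne_zero ξ)
  rw [qPoly_scaled f ξ d hk α]
  simp [hk0, hα, jumpPoint_ne_zero]

lemma exists_fwdDiff_iter_pow_sub_le (d : ℕ) : ∃ C : ℝ, 0 ≤ C ∧ ∀ k t : ℕ, 1 ≤ k → t ≤ d →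
    ‖((fwdDiff 1)^[t] (fun n : ℕ => (n : ℂ) ^ d)) k - d.descFactorial t * (k : ℂ) ^ (d - t)‖ ≤
      C * (k : ℝ) ^ ((d : ℤ) - t - 1) := by
  set e : ℕ → ℕ → ℝ := fun t i =>
    ‖((fwdDiff 1)^[t] (fun z : ℂ => z ^ i)) 0‖ * (d.choose i : ℝ) with he
  have he0 : ∀ t i, 0 ≤ e t i := fun t i => by positivity
  refine ⟨∑ t ∈ Finset.range (d + 1), ∑ i ∈ Finset.range (d + 1), e t i,
    Finset.sum_nonneg fun t _ => Finset.sum_nonneg fun i _ => he0 t i, fun k t hk ht => ?_⟩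
  have hk1 : (1 : ℝ) ≤ k := by exact_mod_cast hk
  have h1 : ((fwdDiff 1)^[t] (fun n : ℕ => (n : ℂ) ^ d)) k =
      ∑ i ∈ Finset.range (d + 1), ((k : ℂ) ^ (d - i) * (d.choose i : ℂ)) *
        ((fwdDiff 1)^[t] (fun z : ℂ => z ^ i)) 0 := by
    have h2 := fwdDiff_iter_comp_add (1 : ℂ) (fun z : ℂ => z ^ d) (k : ℂ) t 0
    rw [zero_add] at h2
    rw [fwdDiff_iter_comp_natCast (fun z => z ^ d), ← h2]
    have h3 : (fun r : ℂ => (r + k) ^ d) = ∑ i ∈ Finset.range (d + 1),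
        ((k : ℂ) ^ (d - i) * (d.choose i : ℂ)) • fun z : ℂ => z ^ i := by
      ext r
      rw [add_pow, Finset.sum_apply]
      exact Finset.sum_congr rfl fun i _ => by simp only [Pi.smul_apply, smul_eq_mul]; ring
    rw [h3, fwdDiff_iter_finsetSum, Finset.sum_apply]
    refine Finset.sum_congr rfl fun i _ => ?_
    rw [fwdDiff_iter_const_smul, Pi.smul_apply, smul_eq_mul]
  have htmem : t ∈ Finset.range (d + 1) := Finset.mem_range.2 (by omega)
  have htop : ((k : ℂ) ^ (d - t) * (d.choose t : ℂ)) *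
      ((fwdDiff 1)^[t] (fun z : ℂ => z ^ t)) 0 = d.descFactorial t * (k : ℂ) ^ (d - t) := by
    rw [fwdDiff_iter_eq_factorial, Nat.descFactorial_eq_factorial_mul_choose]
    simp only [Pi.natCast_apply]
    push_cast
    ring
  rw [h1, ← Finset.add_sum_erase _ _ htmem, htop, add_sub_cancel_left]
  calc _ ≤ ∑ i ∈ (Finset.range (d + 1)).erase t, e t i * (k : ℝ) ^ ((d : ℤ) - t - 1) := by
        refine norm_sum_le_of_le _ fun i hi => ?_
        obtain ⟨hit, hi⟩ := Finset.mem_erase.1 hi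
        have hi' := Finset.mem_range.1 hi
        rcases lt_or_gt_of_ne hit with h | h
        · rw [fwdDiff_iter_pow_eq_zero_of_lt h]
          simp only [Pi.zero_apply, mul_zero, norm_zero]
          exact mul_nonneg (he0 _ _) (by positivity)
        · rw [norm_mul, norm_mul, norm_pow, Complex.norm_natCast, Complex.norm_natCast, he]
          have : (k : ℝ) ^ (d - i) ≤ (k : ℝ) ^ ((d : ℤ) - t - 1) := by
            rw [← zpow_natCast]
            exact zpow_le_zpow_right₀ hk1 (by omega)
          calc _ ≤ (k : ℝ) ^ ((d : ℤ) - t - 1) * (d.choose i : ℝ) *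
                ‖((fwdDiff 1)^[t] (fun z : ℂ => z ^ i)) 0‖ := by gcongr
            _ = _ := by ring
    _ = (∑ i ∈ (Finset.range (d + 1)).erase t, e t i) * (k : ℝ) ^ ((d : ℤ) - t - 1) := by
        rw [Finset.sum_mul]
    _ ≤ _ := by
        gcongr
        calc _ ≤ ∑ i ∈ Finset.range (d + 1), e t i :=
              Finset.sum_le_sum_of_subset_of_nonneg (Finset.erase_subset _ _)
                fun i _ _ => he0 t i
          _ ≤ _ := Finset.single_le_sum (f := fun t => ∑ i ∈ Finset.range (d + 1), e t i)
                (fun t _ => Finset.sum_nonneg fun i _ => he0 t i) htmem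

/-- With `α = A_0 i^d`, the scaled coefficients of `q` are those of the Laguerre polynomial up to
`O(H / k)`, and the constant coefficient, where the jump polynomial drops out, is
`O(H k^{-d-1})`. -/
lemma exists_scaledCoeff_bounds {d d₁ : ℕ} (hd : 2 * d + 1 ≤ d₁) {J : ℝ} (hJ : 0 < J) :
    ∃ C : ℝ, 0 < C ∧ ∀ (f : ℝ → ℝ) (ξ : ℝ) (A : ℕ → ℝ) (R : ℝ), IsSingleJump f ξ d₁ A →
      SmoothPartBound f ξ d₁ A R → J ≤ |A 0| → ∀ k : ℕ, 1 ≤ k →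
      (∀ t ≤ d, ‖scaledCoeff f ξ d k (A 0 * Complex.I ^ d) t - laguerreCoeff d t‖ ≤
        C * sizeH d d₁ A R * (k : ℝ) ^ (-1 : ℤ)) ∧
      ‖scaledCoeff f ξ d k (A 0 * Complex.I ^ d) (d + 1)‖ ≤
        C * sizeH d d₁ A R * (k : ℝ) ^ (-(d : ℤ) - 1) := by
  obtain ⟨B, hB, hsym⟩ := exists_symbolBound_demodulated hd
  obtain ⟨P, hP, hpow⟩ := exists_fwdDiff_iter_pow_sub_le d
  refine ⟨2 ^ (d + 1) * (P + B / J), by positivity, fun f ξ A R hf hR hA k hk => ?_⟩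
  obtain ⟨h1, h2, -⟩ := hsym f ξ A R hf hR k hk
  have hH2 : 2 ≤ sizeH d d₁ A R := two_le_sizeH hR.nonneg
  set H := sizeH d d₁ A R with hH
  set m := demodulated f ξ d with hm
  set α : ℂ := A 0 * Complex.I ^ d with hα
  have hαnorm : ‖α‖ = |A 0| := by simp [hα]
  have hα0 : α ≠ 0 := norm_pos_iff.1 (by rw [hαnorm]; linarith)
  have hαJ : J ≤ ‖α‖ := by rw [hαnorm]; exact hA
  have hk1 : (1 : ℝ) ≤ k := by exact_mod_cast hk
  have hkR : (0 : ℝ) < k := by linarith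
  have hkC : (k : ℂ) ≠ 0 := by exact_mod_cast (by omega : k ≠ 0)
  have hchoose : ∀ t, ((d + 1).choose t : ℝ) ≤ 2 ^ (d + 1) := fun t => by
    exact_mod_cast Nat.choose_le_two_pow (d + 1) t
  constructor
  · intro t ht
    have h2t := h2 t k le_rfl (by omega)
    have hsplit : (fun n : ℕ => m n - (A 0 : ℂ) * (Complex.I * n) ^ d) =
        m + (-α) • fun n : ℕ => (n : ℂ) ^ d := by
      ext n; simp only [Pi.add_apply, Pi.smul_apply, smul_eq_mul, hα, mul_pow]; ring
    rw [hsplit, fwdDiff_iter_add, fwdDiff_iter_const_smul, Pi.add_apply, Pi.smul_apply,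
      smul_eq_mul] at h2t
    set X := ((fwdDiff 1)^[t] m) k with hX
    set Z := ((fwdDiff 1)^[t] (fun n : ℕ => (n : ℂ) ^ d)) k with hZ
    have hz := hpow k t hk ht
    have hkpow : (k : ℂ) ^ (d - t) * (k : ℂ) ^ ((t : ℤ) - d) = 1 := by
      rw [← zpow_natCast, ← zpow_add₀ hkC, show ((d - t : ℕ) : ℤ) + ((t : ℤ) - d) = 0 by omega,
        zpow_zero]
    have heq : scaledCoeff f ξ d k α t - laguerreCoeff d t =
        (-1) ^ t * ((d + 1).choose t : ℂ) * ((k : ℂ) ^ ((t : ℤ) - d) *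
          ((Z - d.descFactorial t * (k : ℂ) ^ (d - t)) + (X + -α * Z) / α)) := by
      rw [scaledCoeff, laguerreCoeff]
      have e : (Z - d.descFactorial t * (k : ℂ) ^ (d - t)) + (X + -α * Z) / α =
          X / α - d.descFactorial t * (k : ℂ) ^ (d - t) := by field_simp; ring
      rw [e]
      linear_combination ((-1) ^ t * ((d + 1).choose t : ℂ) * d.descFactorial t) * hkpow
    -- the first difference is the discretisation error of `n ^ d`, the second one collects all
    -- terms of `m` of order below `d`
    have hinner : ‖(Z - d.descFactorial t * (k : ℂ) ^ (d - t)) + (X + -α * Z) / α‖ ≤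
        (P + B / J) * H * (k : ℝ) ^ ((d : ℤ) - 1 - t) := by
      have hsnd : ‖(X + -α * Z) / α‖ ≤ B / J * H * (k : ℝ) ^ ((d : ℤ) - 1 - t) := by
        rw [norm_div]
        calc _ ≤ B * H * (k : ℝ) ^ ((d : ℤ) - 1 - t) / J := by gcongr
          _ = _ := by ring
      have hfst : ‖Z - d.descFactorial t * (k : ℂ) ^ (d - t)‖ ≤
          P * H * (k : ℝ) ^ ((d : ℤ) - 1 - t) := by
        rw [show (d : ℤ) - 1 - t = d - t - 1 by ring]
        refine hz.trans ?_
        gcongr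
        nlinarith
      calc _ ≤ _ := norm_add_le _ _
        _ ≤ _ := add_le_add hfst hsnd
        _ = _ := by ring
    rw [heq, norm_mul, norm_mul, norm_mul, norm_pow, norm_neg, norm_one, one_pow, one_mul,
      Complex.norm_natCast, norm_zpow, Complex.norm_natCast]
    calc _ ≤ 2 ^ (d + 1) * ((k : ℝ) ^ ((t : ℤ) - d) *
          ((P + B / J) * H * (k : ℝ) ^ ((d : ℤ) - 1 - t))) := by
          gcongr; exact hchoose t
      _ = 2 ^ (d + 1) * (P + B / J) * H *
          ((k : ℝ) ^ ((t : ℤ) - d) * (k : ℝ) ^ ((d : ℤ) - 1 - t)) := by ring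
      _ = _ := by rw [← zpow_add₀ hkR.ne']; congr 2; ring
  · have h1t := h1 (d + 1) k le_rfl (by omega)
    have hsplit : (fun n : ℕ => m n - ∑ l ∈ Finset.range (d + 1),
        (A l : ℂ) * (Complex.I * n) ^ (d - l)) = m + (-1 : ℂ) • fun n : ℕ =>
          ∑ j ∈ Finset.range (d + 1), (Complex.I ^ j * A (d - j)) * (n : ℂ) ^ j := by
      ext n
      rw [Pi.add_apply, Pi.smul_apply, ← sum_fin_eq_sum_pow d n (fun l => (A l : ℂ)),
        ← Fin.sum_univ_eq_sum_range (fun l => (A l : ℂ) * (Complex.I * (n : ℂ)) ^ (d - l)) (d + 1)]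
      simp only [mul_comm (A _ : ℂ)]
      rw [neg_one_smul, sub_eq_add_neg]
    have hzero : ((fwdDiff 1)^[d + 1] (fun n : ℕ => ∑ j ∈ Finset.range (d + 1),
        (Complex.I ^ j * (A (d - j) : ℂ)) * (n : ℂ) ^ j)) k = 0 := by
      rw [fwdDiff_iter_comp_natCast (fun z => ∑ j ∈ Finset.range (d + 1),
        (Complex.I ^ j * (A (d - j) : ℂ)) * z ^ j),
        fwdDiff_iter_sum_mul_pow_eq_zero (fun j => Complex.I ^ j * (A (d - j) : ℂ))]
      rfl
    rw [hsplit, fwdDiff_iter_add, fwdDiff_iter_const_smul, Pi.add_apply, Pi.smul_apply, hzero,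
      smul_zero, add_zero] at h1t
    rw [scaledCoeff, Nat.choose_self, norm_div, norm_mul, norm_mul, norm_mul, norm_pow, norm_neg,
      norm_one, one_pow, one_mul, norm_zpow, Complex.norm_natCast, Complex.norm_natCast]
    rw [show ((d + 1 : ℕ) : ℤ) - d = 1 by push_cast; ring]
    calc _ ≤ ((1 : ℕ) : ℝ) * (B * H * (k : ℝ) ^ (-1 - ((d + 1 : ℕ) : ℤ))) *
          (k : ℝ) ^ (1 : ℤ) / J := by gcongr
      _ = B / J * H * ((k : ℝ) ^ (-1 - ((d + 1 : ℕ) : ℤ)) * (k : ℝ) ^ (1 : ℤ)) := by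
          push_cast; ring
      _ = 1 * (B / J) * H * (k : ℝ) ^ (-(d : ℤ) - 1) := by
          rw [← zpow_add₀ hkR.ne', one_mul]; congr 2; push_cast; ring
      _ ≤ _ := by
          gcongr
          · exact one_le_pow₀ (by norm_num)
          · linarith

/-! ### Localisation of the root closest to the unit circle -/

lemma continuous_qPoly (f : ℝ → ℝ) (d k : ℕ) : Continuous (qPoly f d k) := by
  unfold qPoly
  fun_prop

/-- A point `1 + y / k` close to the unit circle has `Re y` close to `0`. -/
lemma abs_re_le_of_abs_norm_sub_one_le {k δ Y : ℝ} (hk : 0 < k) (hδ : δ ≤ 1) {y : ℂ}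
    (hy : ‖y‖ ≤ Y) (h : |‖1 + y / (k : ℂ)‖ - 1| ≤ δ) :
    |y.re| ≤ 2 * (k * δ) + Y ^ 2 / (2 * k) := by
  set r := ‖1 + y / (k : ℂ)‖ with hr
  have hr2 : r ^ 2 = 1 + 2 * y.re / k + ‖y‖ ^ 2 / k ^ 2 := by
    rw [hr, ← Complex.normSq_eq_norm_sq, ← Complex.normSq_eq_norm_sq, Complex.normSq_apply,
      Complex.normSq_apply, Complex.add_re, Complex.add_im, Complex.div_ofReal_re,
      Complex.div_ofReal_im, Complex.one_re, Complex.one_im]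
    field_simp
    ring
  have hδ0 : 0 ≤ δ := (abs_nonneg _).trans h
  have hr0 : 0 ≤ r := norm_nonneg _
  have hre : y.re = k * ((r - 1) * (r + 1)) / 2 - ‖y‖ ^ 2 / (2 * k) := by
    have : (r - 1) * (r + 1) = 2 * y.re / k + ‖y‖ ^ 2 / k ^ 2 := by linear_combination hr2
    rw [this]; field_simp; ring
  have h1 : |(r - 1) * (r + 1)| ≤ δ * 3 := by
    rw [abs_mul]
    refine mul_le_mul h ?_ (abs_nonneg _) hδ0
    rw [abs_of_nonneg (by linarith)]
    linarith [(abs_le.1 h).2]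
  have h2 : ‖y‖ ^ 2 / (2 * k) ≤ Y ^ 2 / (2 * k) := by gcongr
  rw [hre]
  refine (abs_sub _ _).trans (add_le_add ?_ ?_)
  · rw [abs_div, abs_mul, abs_of_pos hk, abs_two]
    nlinarith [mul_le_mul_of_nonneg_left h1 hk.le, mul_nonneg hk.le hδ0]
  · rw [abs_of_nonneg (by positivity)]
    exact h2

/-- The root of `q` closest to the unit circle approximates the jump location. -/
lemma exists_location_bound {d d₁ : ℕ} (hd : 2 * d + 1 ≤ d₁) {J : ℝ} (hJ : 0 < J) :
    ∃ C₁ K : ℝ, 0 < C₁ ∧ 0 < K ∧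
      ∀ (f : ℝ → ℝ) (ξ : ℝ) (A : ℕ → ℝ) (R : ℝ), IsSingleJump f ξ d₁ A →
        SmoothPartBound f ξ d₁ A R → J ≤ |A 0| →
        ∀ k : ℕ, K * sizeH d d₁ A R < (k : ℝ) →
          (∃ w : ℂ, IsRecoveredLocation f d k w) ∧
          ∀ w : ℂ, IsRecoveredLocation f d k w →
            ‖w - jumpPoint ξ‖ ≤ C₁ * sizeH d d₁ A R * (k : ℝ) ^ (-(d : ℤ) - 2) := by
  obtain ⟨ε, c, Y, hε, hc, hY, hpert⟩ := exists_perturbed_root_bounds d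
  obtain ⟨B, hB, hcoeff⟩ := exists_scaledCoeff_bounds hd hJ
  set C₁ : ℝ := B / c with hC₁
  have hC₁0 : 0 < C₁ := by positivity
  refine ⟨C₁, 1 + B / ε + C₁ + (2 * C₁ + Y ^ 2) / ε, hC₁0, by positivity,
    fun f ξ A R hf hR hA k hkK => ?_⟩
  have hH2 : 2 ≤ sizeH d d₁ A R := two_le_sizeH hR.nonneg
  set H := sizeH d d₁ A R with hH
  have hH0 : 0 < H := by linarith
  have e1 : 0 ≤ B / ε * H := by positivity
  have e2 : 0 ≤ C₁ * H := by positivity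
  have e3 : 0 ≤ (2 * C₁ + Y ^ 2) / ε * H := by positivity
  have hk1 : (1 : ℝ) ≤ k := by linarith
  have hk0 : (0 : ℝ) < k := by linarith
  have hk : 1 ≤ k := by exact_mod_cast hk1
  have hkC : (k : ℂ) ≠ 0 := by exact_mod_cast (by omega : k ≠ 0)
  have hBH : B * H ≤ ε * k := by
    have : B / ε * H ≤ k := by linarith
    calc B * H = ε * (B / ε * H) := by field_simp
      _ ≤ _ := by gcongr
  have hCH : C₁ * H ≤ k := by linarith
  have hCY : (2 * C₁ + Y ^ 2) * H ≤ ε * k := by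
    have : (2 * C₁ + Y ^ 2) / ε * H ≤ k := by linarith
    calc (2 * C₁ + Y ^ 2) * H = ε * ((2 * C₁ + Y ^ 2) / ε * H) := by field_simp
      _ ≤ _ := by gcongr
  obtain ⟨hb, hg⟩ := hcoeff f ξ A R hf hR hA k hk
  rw [← hH] at hb hg
  set α : ℂ := A 0 * Complex.I ^ d with hα
  have hα0 : α ≠ 0 := norm_pos_iff.1 (by
    have : ‖α‖ = |A 0| := by simp [hα]
    rw [this]; linarith)
  have hBε : B * H * (k : ℝ) ^ (-1 : ℤ) ≤ ε := by
    rw [zpow_neg_one, ← div_eq_mul_inv, div_le_iff₀ hk0]; exact hBH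
  have hpow1 : (k : ℝ) ^ (-(d : ℤ) - 1) ≤ (k : ℝ) ^ (-1 : ℤ) :=
    zpow_le_zpow_right₀ hk1 (by omega)
  have hgε : ‖scaledCoeff f ξ d k α (d + 1)‖ ≤ ε := by
    refine hg.trans (le_trans ?_ hBε)
    gcongr
  obtain ⟨⟨y₀, hy₀, hy₀g⟩, hroots⟩ := hpert (scaledCoeff f ξ d k α) _
    (fun t ht => (hb t ht).trans hBε) hgε
  set δ : ℝ := C₁ * H * (k : ℝ) ^ (-(d : ℤ) - 2) with hδ
  have hkδ : k * δ = C₁ * H * (k : ℝ) ^ (-(d : ℤ) - 1) := by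
    rw [hδ, show -(d : ℤ) - 1 = 1 + (-d - 2) by ring, zpow_add₀ hk0.ne' 1, zpow_one]; ring
  have hkδ' : k * δ ≤ C₁ * H / k := by
    rw [hkδ, div_eq_mul_inv, ← zpow_neg_one]
    gcongr
  have hω := norm_jumpPoint ξ
  have hclose : ∀ y : ℂ, c * ‖y‖ ≤ ‖scaledCoeff f ξ d k α (d + 1)‖ →
      ‖jumpPoint ξ * (1 + y / k) - jumpPoint ξ‖ ≤ δ := by
    intro y hy
    have h1 : jumpPoint ξ * (1 + y / k) - jumpPoint ξ = jumpPoint ξ * (y / k) := by ring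
    rw [h1, norm_mul, hω, one_mul, norm_div, Complex.norm_natCast, div_le_iff₀ hk0, mul_comm δ,
      hkδ, hC₁]
    have h2 := hy.trans hg
    rw [← le_div_iff₀' hc] at h2
    exact h2.trans (le_of_eq (by ring))
  have hparam : ∀ w : ℂ, ∃ y : ℂ, w = jumpPoint ξ * (1 + y / k) := fun w =>
    ⟨k * (w / jumpPoint ξ - 1), by field_simp [jumpPoint_ne_zero ξ]; ring⟩
  have hw₀ : qPoly f d k (jumpPoint ξ * (1 + y₀ / k)) = 0 :=
    (qPoly_eq_zero_iff f ξ d hk hα0 y₀).2 hy₀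
  constructor
  · have hsub : {w | qPoly f d k w = 0} ⊆ Metric.closedBall 0 (1 + Y) := by
      intro w hw
      obtain ⟨y, rfl⟩ := hparam w
      have hyY := (hroots y ((qPoly_eq_zero_iff f ξ d hk hα0 y).1 hw)).1
      rw [mem_closedBall_zero_iff, norm_mul, hω, one_mul]
      refine (norm_add_le _ _).trans ?_
      rw [norm_one, norm_div, Complex.norm_natCast]
      gcongr
      exact (div_le_self (norm_nonneg _) hk1).trans hyY
    have hcompact : IsCompact {w | qPoly f d k w = 0} :=
      (isCompact_closedBall (0 : ℂ) (1 + Y)).of_isClosed_subset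
        (isClosed_eq (continuous_qPoly f d k) continuous_const) hsub
    obtain ⟨w, hw, hmin⟩ := hcompact.exists_isMinOn ⟨_, hw₀⟩
      (f := fun w : ℂ => |‖w‖ - 1|) (by fun_prop)
    exact ⟨w, hw, fun z hz => hmin hz⟩
  · intro w hw
    obtain ⟨y, rfl⟩ := hparam w
    obtain ⟨hyY, hyg⟩ := hroots y ((qPoly_eq_zero_iff f ξ d hk hα0 y).1 hw.1)
    refine hclose y (hyg ?_)
    -- minimality: the root is at least as close to the unit circle as the small root `y₀`
    have hcirc : |‖1 + y / ((k : ℝ) : ℂ)‖ - 1| ≤ δ := by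
      have h1 := hw.2 _ hw₀
      rw [norm_mul, hω, one_mul] at h1
      have h2 := abs_norm_sub_norm_le (jumpPoint ξ * (1 + y₀ / k)) (jumpPoint ξ)
      rw [hω] at h2
      rw [Complex.ofReal_natCast]
      exact h1.trans (h2.trans (hclose y₀ hy₀g))
    have hδ0 : 0 ≤ δ := by positivity
    have hδ1 : δ ≤ 1 := by
      have h1 : C₁ * H / k ≤ 1 := by rw [div_le_one hk0]; exact hCH
      nlinarith
    refine (abs_re_le_of_abs_norm_sub_one_le hk0 hδ1 hyY hcirc).trans ?_
    have h3 : (2 * C₁ + Y ^ 2) * H / k ≤ ε := by rw [div_le_iff₀ hk0]; exact hCY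
    have h4 : Y ^ 2 / (2 * k) ≤ Y ^ 2 * H / k := by
      rw [div_le_div_iff₀ (by positivity) hk0]
      nlinarith [mul_pos (pow_pos hY 2) hk0]
    calc 2 * (k * δ) + Y ^ 2 / (2 * k) ≤ 2 * (C₁ * H / k) + Y ^ 2 * H / k := by gcongr
      _ = (2 * C₁ + Y ^ 2) * H / k := by ring
      _ ≤ ε := h3

end JumpReconstruction

theorem mainTheorem2 (d d₁ : ℕ) (hd : 2 * d + 1 ≤ d₁) :
    -- for every approximation of the jump location of order `k^{-d-2}`
    (∀ C₁ : ℝ, ∃ C K : ℝ, 0 < C ∧ 0 < K ∧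
      ∀ (f : ℝ → ℝ) (ξ : ℝ) (A : ℕ → ℝ) (R : ℝ),
        JumpReconstruction.IsSingleJump f ξ d₁ A →
        JumpReconstruction.SmoothPartBound f ξ d₁ A R →
        ∀ k : ℕ, K * JumpReconstruction.sizeH d d₁ A R < (k : ℝ) →
        ∀ w : ℂ,
          ‖w - JumpReconstruction.jumpPoint ξ‖ ≤
              C₁ * JumpReconstruction.sizeH d d₁ A R * (k : ℝ) ^ (-(d : ℤ) - 2) →
          (∃! a : Fin (d + 1) → ℂ, JumpReconstruction.SolvesMagnitudeSystem f d k w a) ∧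
          ∀ a : Fin (d + 1) → ℂ, JumpReconstruction.SolvesMagnitudeSystem f d k w a →
            ∀ l : Fin (d + 1), ‖a l - (A l : ℂ)‖ ≤
              C * JumpReconstruction.sizeH d d₁ A R ^ 2 *
                (k : ℝ) ^ (((l : ℕ) : ℤ) - (d : ℤ) - 1)) ∧
    -- for the location produced by the algorithm, which is such an approximation
    (∀ J : ℝ, 0 < J → ∃ C₁ C K : ℝ, 0 < C₁ ∧ 0 < C ∧ 0 < K ∧
      ∀ (f : ℝ → ℝ) (ξ : ℝ) (A : ℕ → ℝ) (R : ℝ),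
        JumpReconstruction.IsSingleJump f ξ d₁ A →
        JumpReconstruction.SmoothPartBound f ξ d₁ A R →
        J ≤ |A 0| →
        ∀ k : ℕ, K * JumpReconstruction.sizeH d d₁ A R < (k : ℝ) →
          (∃ w : ℂ, JumpReconstruction.IsRecoveredLocation f d k w) ∧
          ∀ w : ℂ, JumpReconstruction.IsRecoveredLocation f d k w →
            ‖w - JumpReconstruction.jumpPoint ξ‖ ≤
                C₁ * JumpReconstruction.sizeH d d₁ A R * (k : ℝ) ^ (-(d : ℤ) - 2) ∧
            (∃! a : Fin (d + 1) → ℂ, JumpReconstruction.SolvesMagnitudeSystem f d k w a) ∧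
            ∀ a : Fin (d + 1) → ℂ, JumpReconstruction.SolvesMagnitudeSystem f d k w a →
              ∀ l : Fin (d + 1), ‖a l - (A l : ℂ)‖ ≤
                C * JumpReconstruction.sizeH d d₁ A R ^ 2 *
                  (k : ℝ) ^ (((l : ℕ) : ℤ) - (d : ℤ) - 1)) := by
  refine ⟨JumpReconstruction.exists_magnitude_bound hd, fun J hJ => ?_⟩
  obtain ⟨C₁, K₁, hC₁, hK₁, hloc⟩ := JumpReconstruction.exists_location_bound hd hJ
  obtain ⟨C, K₂, hC, hK₂, hmag⟩ := JumpReconstruction.exists_magnitude_bound hd C₁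
  refine ⟨C₁, C, K₁ + K₂, hC₁, hC, by positivity, fun f ξ A R hf hR hA k hk => ?_⟩
  have hH := JumpReconstruction.two_le_sizeH (d := d) (d₁ := d₁) (A := A) hR.nonneg
  have h₁ : K₁ * JumpReconstruction.sizeH d d₁ A R < k := by nlinarith
  have h₂ : K₂ * JumpReconstruction.sizeH d d₁ A R < k := by nlinarith
  obtain ⟨hex, hall⟩ := hloc f ξ A R hf hR hA k h₁
  exact ⟨hex, fun w hw => ⟨hall w hw, hmag f ξ A R hf hR k h₂ w (hall w hw)⟩⟩
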